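/- **Klotz model.** For $0\le x\le 1$ and $\max\{0,(2x-1)/x\}\le\lambda\le 1$ (this region of the $(x,\lambda)$-plane is $\mathcal R$; the lower bound for $\lambda$ is $0$ at $x=0$) a system is executed on $n\ge 1$ demands. Let the observed outcomes contain $\alpha$ transitions success$\to$failure, $\beta$ success$\to$success, $\gamma$ failure$\to$failure and $\delta$ failure$\to$success. With $y=\frac{(1-\lambda)x}{1-x}$ the likelihood is $L(x,\lambda)=w\,y^{\alpha}(1-y)^{\beta}\lambda^{\gamma}(1-\lambda)^{\delta}$, where $w=x$ if the first execution fails and $w=1-x$ if it succeeds ($L(1,1)=1$ if all executions fail, $L(1,1)=0$ otherwise). For a prior distribution of $(X,\Lambda)$ on $\mathcal R$ with $\mathbb E[L(X,\Lambda)]>0$ put $P((X,\Lambda)\in S\mid \text{outcomes})=\mathbb E[L(X,\Lambda)\mathbf 1_{(X,\Lambda)\in S}]/\mathbb E[L(X,\Lambda)]$. **Problem.** Let $0\le\epsilon<b<\tfrac12$, $\phi_1,\phi_2\ge 0$, $\phi_1+\phi_2\le 1$, $0\le\theta\le 1$, with $\phi_1+\theta\le 1$ if $\epsilon=0$, and $\theta<1$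 if at least one failure is observed. A prior on $\mathcal R$ is feasible if $P(\Lambda<X)=\phi_1$, $P(\Lambda>X)=\phi_2$, $P(X\le\epsilon)=\theta$. Consider $I=\inf P(X\le b\mid\text{outcomes})$ over all feasible priors with $\mathbb E[L(X,\Lambda)]>0$. A probability measure $\nu$ on $\mathcal R$ *solves the problem* if $\mathbb E_\nu[L]>0$, $P_\nu(X<b\mid\text{outcomes})=I$, and $\nu$ is the weak limit of feasible priors with $\mathbb E[L]>0$ whose values $P(X\le b\mid\text{outcomes})$ converge to $I$. **Limit points.** For each of the parts $A=\{\lambda>x\}$, $B=\{\lambda<x\}$, $D=\{\lambda=x\}$ of $\mathcal R$, call a minimiser of $L$ on the closure of the subset with $x\le\epsilon$ a low point ($A_0,B_0,D_0$; any point if that subset is empty), and a maximiser of $L$ on the closure of the subset with $x>b$ a high point ($A_1,B_1,D_1$). Let $\nu_{a,c,d}$ be the discrete measure that gives probabilities $a$ to $A_0$, $\phi_2-a$ to $A_1$, $c$ to $B_0$, $\phi_1-c$ to $B_1$, $d$ to $D_0$ and $1-\phi_1-\phi_2-d$ to $D_1$. **Theorem 6.** (i) If no failure is observed, one may take $B_0=(\epsilon,0)$,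 $A_0=D_0=(\epsilon,\epsilon)$, $A_1=(b,1)$, $B_1=D_1=(b,b)$. If a failure is observed, low and high points exist, and one may take $A_0=D_0=(0,0)$, and $B_0=(\epsilon,0)$ if $\gamma>0$, $B_0=(0,0)$ if $\gamma=0$. The following hold for every choice of the low and high points. (ii) If $\epsilon>0$ and either there is no failure or $\gamma>0$, the problem is solved by $\nu_{0,\theta,0}$ when $\phi_1\ge\theta$; by $\nu_{0,\phi_1,\theta-\phi_1}$ when $\phi_1\le\theta$ and $\phi_2\le1-\theta$; by $\nu_{\phi_2-(1-\theta),\,\phi_1,\,1-\phi_1-\phi_2}$ when $\phi_2\ge1-\theta$. (iii) If there is a failure and $\gamma=0$, it is solved by $\nu_{\theta,0,0}$ when $\phi_2\ge\theta$; by $\nu_{\phi_2,0,\theta-\phi_2}$ when $\phi_2\le\theta$ and $\phi_1\le1-\theta$; by $\nu_{\phi_2,\,\phi_1-(1-\theta),\,1-\phi_1-\phi_2}$ when $\phi_1\ge1-\theta$. (iv) If $\epsilon=0$, it is solved by $\nu_{0,0,\theta}$ when $\theta\le1-\phi_1-\phi_2$, and by $\nu_{\theta-(1-\phi_1-\phi_2),\,0,\,1-\phi_1-\phi_2}$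 when $\theta\ge1-\phi_1-\phi_2$. (v) If at least one failure is observed, $I=0$. -/

import Mathlib

open MeasureTheory Filter Topology

noncomputable section

/-- The support `R` of the Klotz model, in coordinates `(x, l)`: `x` is the failure-rate and `l`
the probability that a failure is followed by a failure; `0 ≤ x ≤ 1` and
`max {0, (2x-1)/x} ≤ l ≤ 1` (for `x = 0` the lower bound on `l` is `0`). -/
def klotzRegion : Set (ℝ × ℝ) :=
  {p | 0 ≤ p.1 ∧ p.1 ≤ 1 ∧ max 0 ((2 * p.1 - 1) / p.1) ≤ p.2 ∧ p.2 ≤ 1}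

/-- Number of transitions from state `s` to state `t` in a record of `n + 1` executions;
`true` stands for a failed execution and `false` for a successful one. -/
def transitions {n : ℕ} (T : Fin (n + 1) → Bool) (s t : Bool) : ℕ :=
  (Finset.univ.filter fun i : Fin n => T i.castSucc = s ∧ T i.succ = t).card

/-- `P[T_i = 1 | T_{i-1} = 0]` in the Klotz model. -/
def klotzRise (x l : ℝ) : ℝ := (1 - l) * x / (1 - x)

/-- Klotz likelihood of the observed outcomes `T`, as a function of `p = (x, l)`.
The exponents are `α` (success to failure), `β` (success to success), `γ` (failure to failure)
and `δ` (failure to success). -/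
def klotzLikelihood {n : ℕ} (T : Fin (n + 1) → Bool) (p : ℝ × ℝ) : ℝ :=
  (if T 0 = true then p.1 else 1 - p.1)
    * klotzRise p.1 p.2 ^ transitions T false true
    * (1 - klotzRise p.1 p.2) ^ transitions T false false
    * p.2 ^ transitions T true true
    * (1 - p.2) ^ transitions T true false

/-- `P(outcomes)`, when `(X, Λ)` has law `μ`. -/
def evidence {n : ℕ} (T : Fin (n + 1) → Bool) (μ : Measure (ℝ × ℝ)) : ℝ :=
  ∫ p, klotzLikelihood T p ∂μ

/-- `P((X, Λ) ∈ S | outcomes)`, when `(X, Λ)` has prior law `μ`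
(meaningful when `evidence T μ` is positive). -/
def posterior {n : ℕ} (T : Fin (n + 1) → Bool) (μ : Measure (ℝ × ℝ)) (S : Set (ℝ × ℝ)) : ℝ :=
  (∫ p in S, klotzLikelihood T p ∂μ) / evidence T μ

/-- `μ` is a prior distribution over `R` that satisfies `P(Λ < X) = φ₁`, `P(Λ > X) = φ₂` and
`P(X ≤ ε) = θ`. -/
structure IsFeasiblePrior (ε φ₁ φ₂ θ : ℝ) (μ : Measure (ℝ × ℝ)) : Prop where
  isProb : IsProbabilityMeasure μ
  support : μ klotzRegionᶜ = 0
  negDep : μ.real {p | p.2 < p.1} = φ₁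
  posDep : μ.real {p | p.1 < p.2} = φ₂
  goal : μ.real {p | p.1 ≤ ε} = θ

/-- The values of the objective function: all `P(X ≤ b | outcomes)` that come from feasible priors
(under which the outcomes have positive probability, so that the conditional probability makes
sense). -/
def posteriorValues {n : ℕ} (T : Fin (n + 1) → Bool) (ε b φ₁ φ₂ θ : ℝ) : Set ℝ :=
  {c | ∃ μ : Measure (ℝ × ℝ), IsFeasiblePrior ε φ₁ φ₂ θ μ ∧ 0 < evidence T μ ∧
    c = posterior T μ {p | p.1 ≤ b}}

/-- The (limiting) prior `ν` over `R` solves the optimisation problem: `P(X < b | outcomes)`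
under `ν` is the infimum of `P(X ≤ b | outcomes)` over all feasible priors, and `ν` is the weak
limit of feasible priors whose `P(X ≤ b | outcomes)` converges to that infimum. -/
structure SolvesProblem {n : ℕ} (T : Fin (n + 1) → Bool) (ε b φ₁ φ₂ θ : ℝ)
    (ν : Measure (ℝ × ℝ)) : Prop where
  isProb : IsProbabilityMeasure ν
  support : ν klotzRegionᶜ = 0
  evidence_pos : 0 < evidence T ν
  isGLB : IsGLB (posteriorValues T ε b φ₁ φ₂ θ) (posterior T ν {p | p.1 < b})
  isLimit : ∃ μ : ℕ → Measure (ℝ × ℝ),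
    (∀ k, IsFeasiblePrior ε φ₁ φ₂ θ (μ k) ∧ 0 < evidence T (μ k)) ∧
    (∀ f : BoundedContinuousFunction (ℝ × ℝ) ℝ,
      Tendsto (fun k => ∫ p, f p ∂(μ k)) atTop (𝓝 (∫ p, f p ∂ν))) ∧
    Tendsto (fun k => posterior T (μ k) {p | p.1 ≤ b}) atTop (𝓝 (posterior T ν {p | p.1 < b}))

/-- The part of `R` above the diagonal (positive dependence). -/
def regionAbove : Set (ℝ × ℝ) := {p | p ∈ klotzRegion ∧ p.1 < p.2}

/-- The part of `R` below the diagonal (negative dependence). -/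
def regionBelow : Set (ℝ × ℝ) := {p | p ∈ klotzRegion ∧ p.2 < p.1}

/-- The diagonal of `R` (independence). -/
def regionDiag : Set (ℝ × ℝ) := {p | p ∈ klotzRegion ∧ p.2 = p.1}

/-- `p` is a limit point of the subset `S ∩ {x ≤ ε}` of `R` at which the likelihood is smallest
(no condition if the subset is empty, which happens below the diagonal for `ε = 0`). -/
def IsLowDot {n : ℕ} (T : Fin (n + 1) → Bool) (ε : ℝ) (S : Set (ℝ × ℝ)) (p : ℝ × ℝ) : Prop :=
  (S ∩ {q | q.1 ≤ ε}).Nonempty →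
    p ∈ closure (S ∩ {q | q.1 ≤ ε}) ∧
      IsMinOn (klotzLikelihood T) (closure (S ∩ {q | q.1 ≤ ε})) p

/-- `p` is a limit point of the subset `S ∩ {x > b}` of `R` at which the likelihood is largest. -/
def IsHighDot {n : ℕ} (T : Fin (n + 1) → Bool) (b : ℝ) (S : Set (ℝ × ℝ)) (p : ℝ × ℝ) : Prop :=
  p ∈ closure (S ∩ {q | b < q.1}) ∧
    IsMaxOn (klotzLikelihood T) (closure (S ∩ {q | b < q.1})) p

/-- Six locations at which a worst-case prior may put probability: for each of the three parts of
`R` (above, below, diagonal) one location for `x ≤ ε` and one for `x > b`. -/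
structure Dots where
  aboveLow : ℝ × ℝ
  belowLow : ℝ × ℝ
  diagLow : ℝ × ℝ
  aboveHigh : ℝ × ℝ
  belowHigh : ℝ × ℝ
  diagHigh : ℝ × ℝ

/-- The locations are the pessimistic limit points: least likelihood for `x ≤ ε`, greatest
likelihood for `x > b`. -/
structure Dots.IsPessimistic {n : ℕ} (q : Dots) (T : Fin (n + 1) → Bool) (ε b : ℝ) : Prop where
  aboveLow : IsLowDot T ε regionAbove q.aboveLow
  belowLow : IsLowDot T ε regionBelow q.belowLow
  diagLow : IsLowDot T ε regionDiag q.diagLow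
  aboveHigh : IsHighDot T b regionAbove q.aboveHigh
  belowHigh : IsHighDot T b regionBelow q.belowHigh
  diagHigh : IsHighDot T b regionDiag q.diagHigh

/-- The discrete distribution on the six locations that splits the probability `φ₂` above the
diagonal into `a` (low) and `φ₂ - a` (high), the probability `φ₁` below the diagonal into `c` and
`φ₁ - c`, and the probability `1 - φ₁ - φ₂` on the diagonal into `d` and `1 - φ₁ - φ₂ - d`. -/
def Dots.prior (q : Dots) (φ₁ φ₂ a c d : ℝ) : Measure (ℝ × ℝ) :=
  ENNReal.ofReal a • Measure.dirac q.aboveLow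
    + ENNReal.ofReal c • Measure.dirac q.belowLow
    + ENNReal.ofReal d • Measure.dirac q.diagLow
    + ENNReal.ofReal (φ₂ - a) • Measure.dirac q.aboveHigh
    + ENNReal.ofReal (φ₁ - c) • Measure.dirac q.belowHigh
    + ENNReal.ofReal (1 - φ₁ - φ₂ - d) • Measure.dirac q.diagHigh

/-- The locations for failure-free executions. -/
def noFailureDots (ε b : ℝ) : Dots where
  aboveLow := (ε, ε)
  belowLow := (ε, 0)
  diagLow := (ε, ε)
  aboveHigh := (b, 1)
  belowHigh := (b, b)
  diagHigh := (b, b)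

end

/-! The objective is `u / (u + v)`, with `u` the integral of the likelihood `L` over `x ≤ b` and `v`
that over `x > b`; it increases in `u` and decreases in `v`. A pessimistic prior thus places the
mass with `x ≤ ε` where `L` is smallest, and all other mass just beyond `b` where `L` is largest,
separately in the three parts of the region. What remains free is the split of `θ` into masses `a`,
`c`, `d` above, below and on the diagonal (`IsSplit`).

Attainability in the limit: `L` is continuous on the compact region, also at `(1, 1)`, so each of
the six locations is a limit of points of its own part along which `L` converges. Six-point priors
on these points are feasible, and their evidence and posterior converge. Hence a limiting prior
solves the problem as soon as its posterior is a lower bound (`Dots.IsPessimistic.solvesProblem`).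

With a failure, `L` vanishes at `x = 0`, so each relevant low minimum is zero, while the high maxima
are positive. As `θ < 1`, every split gives posterior zero with positive evidence
(`Dots.IsPessimistic.solvesProblem_of_failure`).

Without failures, `L = (1 - x) * (1 - y) ^ β`. The low minima above and on the diagonal agree, and
the one below is no larger; the high maxima below and on the diagonal agree, and the one above is no
smaller. So `u` depends only on `c` and `v` only on `a`, and a split with `a` minimal and `c`
maximal is optimal. `IsFeasiblePrior.exists_split` reduces an arbitrary prior to a split. -/

/-! ### The region: polynomial description and compactness. -/

lemma mem_klotzRegion_iff {p : ℝ × ℝ} :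
    p ∈ klotzRegion ↔ 0 ≤ p.1 ∧ p.1 ≤ 1 ∧ 0 ≤ p.2 ∧ p.2 ≤ 1 ∧ 2 * p.1 - 1 ≤ p.2 * p.1 := by
  simp only [klotzRegion, Set.mem_ofPred_eq, max_le_iff]
  constructor
  · rintro ⟨h0, h1, ⟨h2, h3⟩, h4⟩
    refine ⟨h0, h1, h2, h4, ?_⟩
    rcases h0.eq_or_lt with h | h
    · rw [← h]; norm_num
    · rwa [div_le_iff₀ h] at h3
  · rintro ⟨h0, h1, h2, h4, h3⟩
    refine ⟨h0, h1, ⟨h2, ?_⟩, h4⟩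
    rcases h0.eq_or_lt with h | h
    · rw [← h]; simpa using h2
    · rwa [div_le_iff₀ h]

lemma isClosed_klotzRegion : IsClosed klotzRegion := by
  have : klotzRegion = {p : ℝ × ℝ | 0 ≤ p.1} ∩ {p | p.1 ≤ 1} ∩ {p | 0 ≤ p.2} ∩ {p | p.2 ≤ 1} ∩
      {p | 2 * p.1 - 1 ≤ p.2 * p.1} := by
    ext p
    simp only [mem_klotzRegion_iff, Set.mem_inter_iff, Set.mem_ofPred_eq]
    tauto
  rw [this]
  refine ((((isClosed_le ?_ ?_).inter (isClosed_le ?_ ?_)).inter (isClosed_le ?_ ?_)).inter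
    (isClosed_le ?_ ?_)).inter (isClosed_le ?_ ?_) <;> fun_prop

lemma isCompact_klotzRegion : IsCompact klotzRegion := by
  refine (isCompact_Icc (a := ((0 : ℝ), (0 : ℝ))) (b := (1, 1))).of_isClosed_subset
    isClosed_klotzRegion fun p hp => ?_
  rw [mem_klotzRegion_iff] at hp
  exact ⟨⟨hp.1, hp.2.2.1⟩, ⟨hp.2.1, hp.2.2.2.1⟩⟩

lemma klotzRise_mem_Icc {p : ℝ × ℝ} (hp : p ∈ klotzRegion) :
    0 ≤ klotzRise p.1 p.2 ∧ klotzRise p.1 p.2 ≤ 1 := by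
  obtain ⟨h0, h1, h2, h3, h4⟩ := mem_klotzRegion_iff.1 hp
  refine ⟨div_nonneg (mul_nonneg (by linarith) h0) (by linarith), ?_⟩
  exact div_le_one_of_le₀ (by linarith) (by linarith)

lemma eq_one_of_mem_klotzRegion {p : ℝ × ℝ} (hp : p ∈ klotzRegion) (h : p.1 = 1) : p = (1, 1) := by
  obtain ⟨h0, h1, h2, h3, h4⟩ := mem_klotzRegion_iff.1 hp
  rw [h] at h4
  exact Prod.ext h (by simp only; linarith)

/-! ### Transition counts of constant records. -/

lemma forall_eq_of_transitions_eq_zero {n : ℕ} {T : Fin (n + 1) → Bool} {s : Bool} (h0 : T 0 = s)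
    (h : transitions T s (!s) = 0) (i : Fin (n + 1)) : T i = s := by
  induction i using Fin.induction with
  | zero => exact h0
  | succ i ih =>
    by_contra hne
    rw [transitions, Finset.card_eq_zero, Finset.filter_eq_empty_iff] at h
    refine h (Finset.mem_univ i) ⟨ih, ?_⟩
    cases s <;> simpa using hne

lemma transitions_eq_zero_left {n : ℕ} {T : Fin (n + 1) → Bool} {s : Bool} (h : ∀ i, T i = !s)
    (t : Bool) : transitions T s t = 0 := by
  rw [transitions, Finset.card_eq_zero, Finset.filter_eq_empty_iff]
  intro i _ hi
  rw [h] at hi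
  cases s <;> simp at hi

lemma transitions_eq_zero_right {n : ℕ} {T : Fin (n + 1) → Bool} {t : Bool} (h : ∀ i, T i = !t)
    (s : Bool) : transitions T s t = 0 := by
  rw [transitions, Finset.card_eq_zero, Finset.filter_eq_empty_iff]
  intro i _ hi
  rw [h i.succ] at hi
  cases t <;> simp at hi

/-! ### Bounds, continuity and zeros of the likelihood. -/

section Likelihood

variable {n : ℕ} (T : Fin (n + 1) → Bool)

lemma measurable_klotzLikelihood : Measurable (klotzLikelihood T) := by
  unfold klotzLikelihood klotzRise
  split_ifs <;> fun_prop

/-- On the region, the likelihood is nonnegative and at most its first and its last factor. -/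
lemma klotzLikelihood_bounds {p : ℝ × ℝ} (hp : p ∈ klotzRegion) :
    0 ≤ klotzLikelihood T p ∧
      klotzLikelihood T p ≤ (if T 0 = true then p.1 else 1 - p.1) ∧
      klotzLikelihood T p ≤ (1 - p.2) ^ transitions T true false := by
  obtain ⟨h0, h1, h2, h3, -⟩ := mem_klotzRegion_iff.1 hp
  obtain ⟨y0, y1⟩ := klotzRise_mem_Icc hp
  set y := klotzRise p.1 p.2 with hy
  have w0 : 0 ≤ (if T 0 = true then p.1 else 1 - p.1) := by split_ifs <;> linarith
  have w1 : (if T 0 = true then p.1 else 1 - p.1) ≤ 1 := by split_ifs <;> linarith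
  have e1 : 0 ≤ y ^ transitions T false true := by positivity
  have e1' : y ^ transitions T false true ≤ 1 := pow_le_one₀ y0 y1
  have e2 : 0 ≤ (1 - y) ^ transitions T false false := pow_nonneg (by linarith) _
  have e2' : (1 - y) ^ transitions T false false ≤ 1 := pow_le_one₀ (by linarith) (by linarith)
  have e3 : 0 ≤ p.2 ^ transitions T true true := by positivity
  have e3' : p.2 ^ transitions T true true ≤ 1 := pow_le_one₀ h2 h3
  have e4 : 0 ≤ (1 - p.2) ^ transitions T true false := pow_nonneg (by linarith) _
  have e4' : (1 - p.2) ^ transitions T true false ≤ 1 := pow_le_one₀ (by linarith) (by linarith)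
  unfold klotzLikelihood
  rw [← hy]
  refine ⟨by positivity, ?_, ?_⟩
  · exact mul_le_of_le_one_right (by positivity) e4' |>.trans <|
      (mul_le_of_le_one_right (by positivity) e3').trans <|
      (mul_le_of_le_one_right (by positivity) e2').trans <| mul_le_of_le_one_right w0 e1'
  · exact mul_le_of_le_one_left e4 <| mul_le_one₀ (mul_le_one₀ (mul_le_one₀ w1 e1 e1') e2 e2') e3 e3'

lemma klotzLikelihood_nonneg {p : ℝ × ℝ} (hp : p ∈ klotzRegion) : 0 ≤ klotzLikelihood T p :=
  (klotzLikelihood_bounds T hp).1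

lemma klotzLikelihood_le_one {p : ℝ × ℝ} (hp : p ∈ klotzRegion) : klotzLikelihood T p ≤ 1 := by
  obtain ⟨h0, h1, -⟩ := mem_klotzRegion_iff.1 hp
  refine (klotzLikelihood_bounds T hp).2.1.trans ?_
  split_ifs <;> linarith

/-- Only `(1, 1)` is delicate, where `y` has no limit. Unless all executions fail, `L` is dominated
by a continuous factor that vanishes there: `1 - x` after an initial success, `(1 - λ) ^ δ` after an
initial failure. If all fail, `y` does not occur in `L`. -/
lemma continuousOn_klotzLikelihood : ContinuousOn (klotzLikelihood T) klotzRegion := by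
  intro p hp
  obtain ⟨-, h1, -⟩ := mem_klotzRegion_iff.1 hp
  rcases h1.lt_or_eq with hlt | heq
  · apply ContinuousAt.continuousWithinAt
    have hne : 1 - p.1 ≠ 0 := by linarith
    have hy : ContinuousAt (fun q : ℝ × ℝ => klotzRise q.1 q.2) p := by
      unfold klotzRise
      exact ContinuousAt.div (by fun_prop) (by fun_prop) hne
    unfold klotzLikelihood
    split_ifs <;> fun_prop
  · obtain rfl := eq_one_of_mem_klotzRegion hp heq
    have key : ∀ g : ℝ × ℝ → ℝ, Continuous g → g (1, 1) = 0 →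
        (∀ q ∈ klotzRegion, klotzLikelihood T q ≤ g q) →
        ContinuousWithinAt (klotzLikelihood T) klotzRegion (1, 1) := by
      intro g hg hg0 hle
      have hL : klotzLikelihood T (1, 1) = 0 :=
        le_antisymm ((hle _ hp).trans_eq hg0) (klotzLikelihood_nonneg T hp)
      rw [ContinuousWithinAt, hL]
      refine tendsto_of_tendsto_of_tendsto_of_le_of_le' tendsto_const_nhds
        (by simpa only [ContinuousWithinAt, hg0] using
          hg.continuousWithinAt (s := klotzRegion) (x := (1, 1))) ?_ ?_
      · filter_upwards [self_mem_nhdsWithin] with q hq using klotzLikelihood_nonneg T hq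
      · filter_upwards [self_mem_nhdsWithin] with q hq using hle q hq
    by_cases h0 : T 0 = true
    · by_cases hδ : transitions T true false = 0
      · have hall := forall_eq_of_transitions_eq_zero h0 hδ
        have : klotzLikelihood T = fun q => q.1 * q.2 ^ transitions T true true := by
          ext q
          simp [klotzLikelihood, h0, hδ,
            transitions_eq_zero_left (T := T) (s := false) (by simpa using hall)]
        rw [this]
        fun_prop
      · refine key (fun q => (1 - q.2) ^ transitions T true false) (by fun_prop) (by simp [hδ])
          fun q hq => (klotzLikelihood_bounds T hq).2.2
    · refine key (fun q => 1 - q.1) (by fun_prop) (by simp) fun q hq => ?_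
      simpa [h0] using (klotzLikelihood_bounds T hq).2.1

lemma klotzLikelihood_pos {p : ℝ × ℝ} (hx0 : 0 < p.1) (hx1 : p.1 < 1) (hl0 : 0 < p.2)
    (hl1 : p.2 < 1) (h : 2 * p.1 - 1 < p.2 * p.1) : 0 < klotzLikelihood T p := by
  have y0 : 0 < klotzRise p.1 p.2 := div_pos (mul_pos (by linarith) hx0) (by linarith)
  have y1 : 0 < 1 - klotzRise p.1 p.2 := by
    rw [sub_pos, klotzRise, div_lt_one (by linarith)]
    linarith
  have : 0 < 1 - p.2 := by linarith
  have w : 0 < (if T 0 = true then p.1 else 1 - p.1) := by split_ifs <;> linarith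
  unfold klotzLikelihood
  positivity

variable {T}

/-- Either the first execution fails and the factor `x` is zero, or a later failure forces a
success-to-failure transition, so that `y ^ α` vanishes. -/
lemma klotzLikelihood_zero_of_failure (hT : ∃ i, T i = true) (l : ℝ) :
    klotzLikelihood T (0, l) = 0 := by
  by_cases h0 : T 0 = true
  · simp [klotzLikelihood, h0]
  · have : transitions T false true ≠ 0 := fun h => by
      obtain ⟨i, hi⟩ := hT
      have := forall_eq_of_transitions_eq_zero (s := false) (by simpa using h0) h i
      simp [hi] at this
    simp [klotzLikelihood, klotzRise, this]

lemma klotzLikelihood_of_forall_false (hT : ∀ i, T i = false) (p : ℝ × ℝ) :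
    klotzLikelihood T p = (1 - p.1) * (1 - klotzRise p.1 p.2) ^ transitions T false false := by
  simp [klotzLikelihood, hT 0, transitions_eq_zero_left (T := T) (s := true) (by simpa using hT),
    transitions_eq_zero_right (T := T) (t := true) (by simpa using hT)]

end Likelihood

/-! ### Limit points of the parts of the region. -/

lemma regionAbove_subset : regionAbove ⊆ klotzRegion := fun _ h => h.1

lemma regionBelow_subset : regionBelow ⊆ klotzRegion := fun _ h => h.1

lemma regionDiag_subset : regionDiag ⊆ klotzRegion := fun _ h => h.1

lemma closure_inter_subset_klotzRegion {S : Set (ℝ × ℝ)} (hS : S ⊆ klotzRegion)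
    (U : Set (ℝ × ℝ)) : closure (S ∩ U) ⊆ klotzRegion :=
  closure_minimal (Set.inter_subset_left.trans hS) isClosed_klotzRegion

lemma fst_le_of_mem_closure {S : Set (ℝ × ℝ)} {ε : ℝ} {p : ℝ × ℝ}
    (hp : p ∈ closure (S ∩ {q | q.1 ≤ ε})) : p.1 ≤ ε :=
  closure_minimal (t := {q : ℝ × ℝ | q.1 ≤ ε}) Set.inter_subset_right
    (isClosed_le continuous_fst continuous_const) hp

lemma le_fst_of_mem_closure {S : Set (ℝ × ℝ)} {b : ℝ} {p : ℝ × ℝ}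
    (hp : p ∈ closure (S ∩ {q | b < q.1})) : b ≤ p.1 :=
  closure_minimal (t := {q : ℝ × ℝ | b ≤ q.1}) (fun q h => le_of_lt (show b < q.1 from h.2))
    (isClosed_le continuous_const continuous_fst) hp

/-- `p` is a limit of points of `S` along which the likelihood converges. -/
lemma exists_seq_of_mem_closure {n : ℕ} (T : Fin (n + 1) → Bool) {S : Set (ℝ × ℝ)}
    (hS : S ⊆ klotzRegion) {p : ℝ × ℝ} (hp : p ∈ closure S) :
    ∃ s : ℕ → ℝ × ℝ, (∀ k, s k ∈ S) ∧ Tendsto s atTop (𝓝 p) ∧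
      Tendsto (fun k => klotzLikelihood T (s k)) atTop (𝓝 (klotzLikelihood T p)) := by
  obtain ⟨s, hs, hlim⟩ := mem_closure_iff_seq_limit.1 hp
  refine ⟨s, hs, hlim, ?_⟩
  have hpR : p ∈ klotzRegion := closure_minimal hS isClosed_klotzRegion hp
  exact (continuousOn_klotzLikelihood T p hpR).tendsto.comp
    (tendsto_nhdsWithin_iff.2 ⟨hlim, Eventually.of_forall fun k => hS (hs k)⟩)

/-! ### Six-point priors and passage to the limit. -/

/-- An admissible choice of the probabilities put at `x ≤ ε` above, below and on the diagonal. -/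
structure IsSplit (ε φ₁ φ₂ θ a c d : ℝ) : Prop where
  above_nonneg : 0 ≤ a
  above_le : a ≤ φ₂
  below_nonneg : 0 ≤ c
  below_le : c ≤ φ₁
  diag_nonneg : 0 ≤ d
  diag_le : d ≤ 1 - φ₁ - φ₂
  sum_eq : a + c + d = θ
  below_eq_zero : ε = 0 → c = 0

/-- The locations lie in the parts of the region that they stand for (no condition for the low
location below the diagonal if it has probability `c = 0`). -/
structure Dots.Admissible (q : Dots) (ε b c : ℝ) : Prop where
  aboveLow : q.aboveLow ∈ regionAbove ∩ {p | p.1 ≤ ε}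
  belowLow : c ≠ 0 → q.belowLow ∈ regionBelow ∩ {p | p.1 ≤ ε}
  diagLow : q.diagLow ∈ regionDiag ∩ {p | p.1 ≤ ε}
  aboveHigh : q.aboveHigh ∈ regionAbove ∩ {p | b < p.1}
  belowHigh : q.belowHigh ∈ regionBelow ∩ {p | b < p.1}
  diagHigh : q.diagHigh ∈ regionDiag ∩ {p | b < p.1}

section Prior

variable {ε b φ₁ φ₂ θ a c d : ℝ}

/-- The split makes all six weights nonnegative, so truncation by `ENNReal.ofReal` loses nothing. -/
lemma integral_prior (q : Dots) (h : IsSplit ε φ₁ φ₂ θ a c d) (f : ℝ × ℝ → ℝ) :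
    ∫ p, f p ∂(q.prior φ₁ φ₂ a c d) =
      (a * f q.aboveLow + c * f q.belowLow + d * f q.diagLow) +
      ((φ₂ - a) * f q.aboveHigh + (φ₁ - c) * f q.belowHigh +
        (1 - φ₁ - φ₂ - d) * f q.diagHigh) := by
  have hi : ∀ (w : ℝ) (p : ℝ × ℝ), Integrable f (ENNReal.ofReal w • Measure.dirac p) := fun w p =>
    (integrable_dirac (by simp)).smul_measure ENNReal.ofReal_ne_top
  have hI : ∀ {w : ℝ} (p : ℝ × ℝ), 0 ≤ w →
      ∫ x, f x ∂(ENNReal.ofReal w • Measure.dirac p) = w * f p := fun p hw => by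
    rw [integral_smul_measure, integral_dirac, ENNReal.toReal_ofReal hw, smul_eq_mul]
  unfold Dots.prior
  rw [integral_add_measure ((((hi _ _).add_measure (hi _ _)).add_measure (hi _ _)).add_measure
      (hi _ _) |>.add_measure (hi _ _)) (hi _ _),
    integral_add_measure ((((hi _ _).add_measure (hi _ _)).add_measure (hi _ _)).add_measure
      (hi _ _)) (hi _ _),
    integral_add_measure (((hi _ _).add_measure (hi _ _)).add_measure (hi _ _)) (hi _ _),
    integral_add_measure ((hi _ _).add_measure (hi _ _)) (hi _ _),
    integral_add_measure (hi _ _) (hi _ _),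
    hI _ h.above_nonneg, hI _ h.below_nonneg, hI _ h.diag_nonneg,
    hI _ (sub_nonneg.2 h.above_le), hI _ (sub_nonneg.2 h.below_le), hI _ (sub_nonneg.2 h.diag_le)]
  ring

instance isFiniteMeasure_prior (q : Dots) : IsFiniteMeasure (q.prior φ₁ φ₂ a c d) :=
  ⟨by simp [Dots.prior]⟩

open Classical in
lemma real_prior (q : Dots) (h : IsSplit ε φ₁ φ₂ θ a c d) {S : Set (ℝ × ℝ)}
    (hS : MeasurableSet S) :
    (q.prior φ₁ φ₂ a c d).real S =
      (a * (if q.aboveLow ∈ S then 1 else 0) + c * (if q.belowLow ∈ S then 1 else 0) +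
        d * (if q.diagLow ∈ S then 1 else 0)) +
      ((φ₂ - a) * (if q.aboveHigh ∈ S then 1 else 0) +
        (φ₁ - c) * (if q.belowHigh ∈ S then 1 else 0) +
        (1 - φ₁ - φ₂ - d) * (if q.diagHigh ∈ S then 1 else 0)) := by
  rw [← integral_indicator_one hS, integral_prior q h]
  simp only [Set.indicator_apply, Pi.one_apply]

lemma isProbabilityMeasure_prior (q : Dots) (h : IsSplit ε φ₁ φ₂ θ a c d) :
    IsProbabilityMeasure (q.prior φ₁ φ₂ a c d) := by
  rw [isProbabilityMeasure_iff_real, real_prior q h MeasurableSet.univ]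
  simp only [Set.mem_univ, if_true]
  ring

lemma prior_compl_klotzRegion (q : Dots) (h : IsSplit ε φ₁ φ₂ θ a c d)
    (h₁ : q.aboveLow ∈ klotzRegion) (h₂ : c ≠ 0 → q.belowLow ∈ klotzRegion)
    (h₃ : q.diagLow ∈ klotzRegion) (h₄ : q.aboveHigh ∈ klotzRegion)
    (h₅ : q.belowHigh ∈ klotzRegion) (h₆ : q.diagHigh ∈ klotzRegion) :
    q.prior φ₁ φ₂ a c d klotzRegionᶜ = 0 := by
  rw [← measureReal_eq_zero_iff, real_prior q h isClosed_klotzRegion.measurableSet.compl]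
  by_cases hc : c = 0
  · simp [h₁, h₃, h₄, h₅, h₆, hc]
  · simp [h₁, h₂ hc, h₃, h₄, h₅, h₆]

lemma measurableSet_below : MeasurableSet {p : ℝ × ℝ | p.2 < p.1} :=
  measurableSet_lt measurable_snd measurable_fst

lemma measurableSet_above : MeasurableSet {p : ℝ × ℝ | p.1 < p.2} :=
  measurableSet_lt measurable_fst measurable_snd

lemma measurableSet_fst_le (t : ℝ) : MeasurableSet {p : ℝ × ℝ | p.1 ≤ t} :=
  measurableSet_le measurable_fst measurable_const

lemma measurableSet_fst_lt (t : ℝ) : MeasurableSet {p : ℝ × ℝ | p.1 < t} :=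
  measurableSet_lt measurable_fst measurable_const

lemma Dots.Admissible.isFeasiblePrior {q : Dots} (hq : q.Admissible ε b c) (hεb : ε < b)
    (h : IsSplit ε φ₁ φ₂ θ a c d) : IsFeasiblePrior ε φ₁ φ₂ θ (q.prior φ₁ φ₂ a c d) := by
  obtain ⟨⟨⟨r₁, s₁⟩, t₁⟩, h₂, ⟨⟨r₃, s₃⟩, t₃⟩, ⟨⟨r₄, s₄⟩, t₄⟩, ⟨⟨r₅, s₅⟩, t₅⟩, ⟨⟨r₆, s₆⟩, t₆⟩⟩ := hq
  simp only [Set.mem_ofPred_eq] at t₁ t₃ t₄ t₅ t₆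
  have t₄' : ¬ q.aboveHigh.1 ≤ ε := by linarith
  have t₅' : ¬ q.belowHigh.1 ≤ ε := by linarith
  have t₆' : ¬ q.diagHigh.1 ≤ ε := by linarith
  refine ⟨isProbabilityMeasure_prior q h,
    prior_compl_klotzRegion q h r₁ (fun hc => (h₂ hc).1.1) r₃ r₄ r₅ r₆, ?_, ?_, ?_⟩
  · rw [real_prior q h measurableSet_below]
    by_cases hc : c = 0
    · simp [s₁.not_gt, s₃, s₄.not_gt, s₅, s₆, hc]
    · simp [s₁.not_gt, show q.belowLow.2 < q.belowLow.1 from (h₂ hc).1.2, s₃, s₄.not_gt, s₅, s₆]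
  · rw [real_prior q h measurableSet_above]
    by_cases hc : c = 0
    · simp [s₁, s₃, s₄, s₅.not_gt, s₆, hc]
    · have s₂ : q.belowLow.2 < q.belowLow.1 := (h₂ hc).1.2
      simp [s₁, s₂.not_gt, s₃, s₄, s₅.not_gt, s₆]
  · rw [real_prior q h (measurableSet_fst_le ε), ← h.sum_eq]
    by_cases hc : c = 0
    · simp [t₁, t₃, t₄', t₅', t₆', hc]
    · have := (h₂ hc).2
      simp only [Set.mem_ofPred_eq] at this
      simp [t₁, this, t₃, t₄', t₅', t₆']

variable {n : ℕ} (T : Fin (n + 1) → Bool)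

/-- Evidence and posterior under a prior on six locations, for an event that separates the low
from the high locations. -/
lemma posterior_prior (q : Dots) (h : IsSplit ε φ₁ φ₂ θ a c d) {S : Set (ℝ × ℝ)}
    (hS : MeasurableSet S) (h₁ : q.aboveLow ∈ S) (h₂ : c ≠ 0 → q.belowLow ∈ S)
    (h₃ : q.diagLow ∈ S) (h₄ : q.aboveHigh ∉ S) (h₅ : q.belowHigh ∉ S) (h₆ : q.diagHigh ∉ S) :
    posterior T (q.prior φ₁ φ₂ a c d) S =
      (a * klotzLikelihood T q.aboveLow + c * klotzLikelihood T q.belowLow +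
        d * klotzLikelihood T q.diagLow) / evidence T (q.prior φ₁ φ₂ a c d) := by
  rw [posterior, ← integral_indicator hS, integral_prior q h]
  by_cases hc : c = 0
  · simp [h₁, h₃, h₄, h₅, h₆, hc]
  · simp [h₁, h₂ hc, h₃, h₄, h₅, h₆]

/-- A prior on limit points solves the problem if its posterior probability is a lower bound. -/
lemma Dots.IsPessimistic.solvesProblem {q : Dots} (hq : q.IsPessimistic T ε b) (hε : 0 ≤ ε)
    (hεb : ε < b) (hb : b < 1 / 2) (h : IsSplit ε φ₁ φ₂ θ a c d)
    (hpos : 0 < evidence T (q.prior φ₁ φ₂ a c d))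
    (hlb : posterior T (q.prior φ₁ φ₂ a c d) {p | p.1 < b} ∈
      lowerBounds (posteriorValues T ε b φ₁ φ₂ θ)) :
    SolvesProblem T ε b φ₁ φ₂ θ (q.prior φ₁ φ₂ a c d) := by
  have m₁ := (hq.aboveLow ⟨(0, 1), ⟨by simp [mem_klotzRegion_iff], by simp⟩, hε⟩).1
  have m₃ := (hq.diagLow ⟨(0, 0), ⟨by simp [mem_klotzRegion_iff], by simp⟩, hε⟩).1
  have m₂ : c ≠ 0 → q.belowLow ∈ closure (regionBelow ∩ {p | p.1 ≤ ε}) := fun hc => by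
    have hε' : 0 < ε := hε.lt_of_ne fun h' => hc (h.below_eq_zero h'.symm)
    refine (hq.belowLow ⟨(ε, 0), ⟨?_, hε'⟩, le_refl ε⟩).1
    rw [mem_klotzRegion_iff]
    refine ⟨hε, ?_, le_refl _, zero_le_one, ?_⟩ <;> simp only <;> linarith
  have m₄ := hq.aboveHigh.1
  have m₅ := hq.belowHigh.1
  have m₆ := hq.diagHigh.1
  obtain ⟨s₁, i₁, l₁, k₁⟩ := exists_seq_of_mem_closure T
    (Set.inter_subset_left.trans regionAbove_subset) m₁
  obtain ⟨s₃, i₃, l₃, k₃⟩ := exists_seq_of_mem_closure T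
    (Set.inter_subset_left.trans regionDiag_subset) m₃
  obtain ⟨s₄, i₄, l₄, k₄⟩ := exists_seq_of_mem_closure T
    (Set.inter_subset_left.trans regionAbove_subset) m₄
  obtain ⟨s₅, i₅, l₅, k₅⟩ := exists_seq_of_mem_closure T
    (Set.inter_subset_left.trans regionBelow_subset) m₅
  obtain ⟨s₆, i₆, l₆, k₆⟩ := exists_seq_of_mem_closure T
    (Set.inter_subset_left.trans regionDiag_subset) m₆
  -- For `c = 0` the part below may contain no point with `x ≤ ε`; a constant sequence then serves,
  -- since its weight is zero.
  obtain ⟨s₂, i₂, l₂, k₂⟩ : ∃ s : ℕ → ℝ × ℝ,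
      (∀ k, c ≠ 0 → s k ∈ regionBelow ∩ {p | p.1 ≤ ε}) ∧ Tendsto s atTop (𝓝 q.belowLow) ∧
      Tendsto (fun k => klotzLikelihood T (s k)) atTop (𝓝 (klotzLikelihood T q.belowLow)) := by
    by_cases hc : c = 0
    · exact ⟨fun _ => q.belowLow, fun _ h' => absurd hc h', tendsto_const_nhds, tendsto_const_nhds⟩
    · obtain ⟨s, i, l, k⟩ := exists_seq_of_mem_closure T
        (Set.inter_subset_left.trans regionBelow_subset) (m₂ hc)
      exact ⟨s, fun k _ => i k, l, k⟩
  let Q : ℕ → Dots := fun k => ⟨s₁ k, s₂ k, s₃ k, s₄ k, s₅ k, s₆ k⟩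
  have hQ : ∀ k, (Q k).Admissible ε b c := fun k => ⟨i₁ k, i₂ k, i₃ k, i₄ k, i₅ k, i₆ k⟩
  have hev : Tendsto (fun k => evidence T ((Q k).prior φ₁ φ₂ a c d)) atTop
      (𝓝 (evidence T (q.prior φ₁ φ₂ a c d))) := by
    simp only [evidence, integral_prior _ h]
    exact (((k₁.const_mul _).add (k₂.const_mul _)).add (k₃.const_mul _)).add
      (((k₄.const_mul _).add (k₅.const_mul _)).add (k₆.const_mul _))
  have hpost : Tendsto (fun k => posterior T ((Q k).prior φ₁ φ₂ a c d) {p | p.1 ≤ b}) atTop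
      (𝓝 (posterior T (q.prior φ₁ φ₂ a c d) {p | p.1 < b})) := by
    rw [posterior_prior T q h (measurableSet_fst_lt b)
      ((fst_le_of_mem_closure m₁).trans_lt hεb)
      (fun hc => (fst_le_of_mem_closure (m₂ hc)).trans_lt hεb)
      ((fst_le_of_mem_closure m₃).trans_lt hεb) (not_lt.2 (le_fst_of_mem_closure m₄))
      (not_lt.2 (le_fst_of_mem_closure m₅)) (not_lt.2 (le_fst_of_mem_closure m₆))]
    have t₄ : ∀ k, ¬ (s₄ k).1 ≤ b := fun k => not_le_of_gt (i₄ k).2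
    have t₅ : ∀ k, ¬ (s₅ k).1 ≤ b := fun k => not_le_of_gt (i₅ k).2
    have t₆ : ∀ k, ¬ (s₆ k).1 ≤ b := fun k => not_le_of_gt (i₆ k).2
    have : ∀ k, posterior T ((Q k).prior φ₁ φ₂ a c d) {p | p.1 ≤ b} = _ := fun k =>
      posterior_prior T (Q k) h (measurableSet_fst_le b) ((i₁ k).2.trans hεb.le)
        (fun hc => (i₂ k hc).2.trans hεb.le) ((i₃ k).2.trans hεb.le) (t₄ k) (t₅ k) (t₆ k)
    simp only [this]
    exact (((k₁.const_mul _).add (k₂.const_mul _)).add (k₃.const_mul _)).div hev hpos.ne'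
  -- Positive evidence holds only from some index on, so the approximating sequence is shifted by
  -- `N`.
  obtain ⟨N, hN⟩ := eventually_atTop.1 (hev.eventually (lt_mem_nhds hpos))
  have hlim : ∃ μ : ℕ → Measure (ℝ × ℝ),
      (∀ k, IsFeasiblePrior ε φ₁ φ₂ θ (μ k) ∧ 0 < evidence T (μ k)) ∧
      (∀ f : BoundedContinuousFunction (ℝ × ℝ) ℝ, Tendsto (fun k => ∫ p, f p ∂(μ k)) atTop
        (𝓝 (∫ p, f p ∂(q.prior φ₁ φ₂ a c d)))) ∧
      Tendsto (fun k => posterior T (μ k) {p | p.1 ≤ b}) atTop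
        (𝓝 (posterior T (q.prior φ₁ φ₂ a c d) {p | p.1 < b})) := by
    refine ⟨fun k => (Q (k + N)).prior φ₁ φ₂ a c d,
      fun k => ⟨(hQ _).isFeasiblePrior hεb h, hN _ (Nat.le_add_left N k)⟩, fun f => ?_,
      (tendsto_add_atTop_iff_nat N).2 hpost⟩
    refine (tendsto_add_atTop_iff_nat (f := fun k => ∫ p, f p ∂((Q k).prior φ₁ φ₂ a c d)) N).2 ?_
    simp only [integral_prior _ h]
    have hf : ∀ {s : ℕ → ℝ × ℝ} {p : ℝ × ℝ}, Tendsto s atTop (𝓝 p) →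
        Tendsto (fun k => f (s k)) atTop (𝓝 (f p)) := fun hs => (f.continuous.tendsto _).comp hs
    exact ((((hf l₁).const_mul _).add ((hf l₂).const_mul _)).add ((hf l₃).const_mul _)).add
      ((((hf l₄).const_mul _).add ((hf l₅).const_mul _)).add ((hf l₆).const_mul _))
  refine ⟨isProbabilityMeasure_prior q h, ?_, hpos, ⟨hlb, fun x hx => ?_⟩, hlim⟩
  · exact prior_compl_klotzRegion q h (closure_inter_subset_klotzRegion regionAbove_subset _ m₁)
      (fun hc => closure_inter_subset_klotzRegion regionBelow_subset _ (m₂ hc))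
      (closure_inter_subset_klotzRegion regionDiag_subset _ m₃)
      (closure_inter_subset_klotzRegion regionAbove_subset _ m₄)
      (closure_inter_subset_klotzRegion regionBelow_subset _ m₅)
      (closure_inter_subset_klotzRegion regionDiag_subset _ m₆)
  -- The posterior of the limit is itself a limit of attained values, so no lower bound exceeds it.
  · obtain ⟨μ, hμ, -, hμlim⟩ := hlim
    exact ge_of_tendsto' hμlim fun k => hx ⟨μ k, (hμ k).1, (hμ k).2, rfl⟩

end Prior

/-! ### Reduction of an arbitrary feasible prior to a split. -/

section Bound

variable {n : ℕ} {T : Fin (n + 1) → Bool} {ε b φ₁ φ₂ θ : ℝ}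

lemma IsFeasiblePrior.ae_mem {μ : Measure (ℝ × ℝ)} (hμ : IsFeasiblePrior ε φ₁ φ₂ θ μ) :
    ∀ᵐ p ∂μ, p ∈ klotzRegion := by
  rw [ae_iff]
  exact hμ.support

lemma IsFeasiblePrior.integrable {μ : Measure (ℝ × ℝ)} (hμ : IsFeasiblePrior ε φ₁ φ₂ θ μ) :
    Integrable (klotzLikelihood T) μ := by
  have := hμ.isProb
  refine Integrable.of_bound (measurable_klotzLikelihood T).aestronglyMeasurable 1 ?_
  filter_upwards [hμ.ae_mem] with p hp
  rw [Real.norm_of_nonneg (klotzLikelihood_nonneg T hp)]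
  exact klotzLikelihood_le_one T hp

lemma posterior_nonneg {μ : Measure (ℝ × ℝ)} (hμ : IsFeasiblePrior ε φ₁ φ₂ θ μ)
    (S : Set (ℝ × ℝ)) : 0 ≤ posterior T μ S := by
  have h : 0 ≤ᵐ[μ] klotzLikelihood T := by
    filter_upwards [hμ.ae_mem] with p hp using klotzLikelihood_nonneg T hp
  exact div_nonneg (integral_nonneg_of_ae (ae_restrict_of_ae h)) (integral_nonneg_of_ae h)

/-- The probabilities of the three parts within a half plane add up. -/
lemma measureReal_trichotomy (μ : Measure (ℝ × ℝ)) [IsFiniteMeasure μ] (U : Set (ℝ × ℝ)) :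
    μ.real (U ∩ {p | p.1 < p.2}) + μ.real (U ∩ {p | p.2 < p.1}) + μ.real (U ∩ {p | p.2 = p.1}) =
      μ.real U := by
  rw [← measureReal_inter_add_sdiff (s := U) measurableSet_above, add_assoc,
    ← measureReal_inter_add_sdiff (s := U \ {p : ℝ × ℝ | p.1 < p.2}) measurableSet_below]
  congr 3
  · ext p
    simp only [Set.mem_inter_iff, Set.mem_sdiff, Set.mem_ofPred_eq, not_lt]
    exact ⟨fun h => ⟨⟨h.1, h.2.le⟩, h.2⟩, fun h => ⟨h.1.1, h.2⟩⟩
  · ext p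
    simp only [Set.mem_inter_iff, Set.mem_sdiff, Set.mem_ofPred_eq, not_lt]
    exact ⟨fun h => ⟨⟨h.1, h.2.le⟩, h.2.ge⟩, fun h => ⟨h.1.1, le_antisymm h.1.2 h.2⟩⟩

/-- Bounds for the likelihood on the low and on the high part bound the integrals of the
likelihood under a feasible prior, for some split of the probability. -/
lemma IsFeasiblePrior.exists_split {μ : Measure (ℝ × ℝ)} (hμ : IsFeasiblePrior ε φ₁ φ₂ θ μ)
    (hεb : ε < b) {lA lB lD hA hB hD : ℝ}
    (hlA : ∀ p ∈ regionAbove, p.1 ≤ ε → lA ≤ klotzLikelihood T p)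
    (hlB : ∀ p ∈ regionBelow, p.1 ≤ ε → lB ≤ klotzLikelihood T p)
    (hlD : ∀ p ∈ regionDiag, p.1 ≤ ε → lD ≤ klotzLikelihood T p)
    (hhA : ∀ p ∈ regionAbove, b < p.1 → klotzLikelihood T p ≤ hA)
    (hhB : ∀ p ∈ regionBelow, b < p.1 → klotzLikelihood T p ≤ hB)
    (hhD : ∀ p ∈ regionDiag, b < p.1 → klotzLikelihood T p ≤ hD)
    (hA0 : 0 ≤ hA) (hB0 : 0 ≤ hB) (hD0 : 0 ≤ hD) :
    ∃ a c d, IsSplit ε φ₁ φ₂ θ a c d ∧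
      a * lA + c * lB + d * lD ≤ ∫ p in {p | p.1 ≤ b}, klotzLikelihood T p ∂μ ∧
      evidence T μ - ∫ p in {p | p.1 ≤ b}, klotzLikelihood T p ∂μ ≤
        (φ₂ - a) * hA + (φ₁ - c) * hB + (1 - φ₁ - φ₂ - d) * hD := by
  have := hμ.isProb
  set U : Set (ℝ × ℝ) := {p | p.1 ≤ ε} with hU
  set V : Set (ℝ × ℝ) := {p | b < p.1} with hV
  set SA : Set (ℝ × ℝ) := {p | p.1 < p.2} with hSA
  set SB : Set (ℝ × ℝ) := {p | p.2 < p.1} with hSB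
  set SD : Set (ℝ × ℝ) := {p | p.2 = p.1} with hSD
  have mU : MeasurableSet U := measurableSet_fst_le ε
  have mV : MeasurableSet V := measurableSet_lt measurable_const measurable_fst
  have mA : MeasurableSet SA := measurableSet_above
  have mB : MeasurableSet SB := measurableSet_below
  have mD : MeasurableSet SD := measurableSet_eq_fun measurable_snd measurable_fst
  have hUV : Disjoint U V := Set.disjoint_left.2 fun p (h : p.1 ≤ ε) (h' : b < p.1) => by linarith
  -- An inequality only, because mass may lie in the strip `ε < x ≤ b`.
  have hle : ∀ S, MeasurableSet S → μ.real (U ∩ S) + μ.real (V ∩ S) ≤ μ.real S := fun S hS => by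
    rw [← measureReal_union (hUV.mono Set.inter_subset_left Set.inter_subset_left) (mV.inter hS)]
    exact measureReal_mono (Set.union_subset Set.inter_subset_right Set.inter_subset_right)
  have hDeq : μ.real SD = 1 - φ₁ - φ₂ := by
    have := measureReal_trichotomy μ Set.univ
    simp only [Set.univ_inter, probReal_univ] at this
    rw [hμ.negDep, hμ.posDep] at this
    linarith
  have eA := hle SA mA
  have eB := hle SB mB
  have eD := hle SD mD
  rw [hμ.posDep] at eA
  rw [hμ.negDep] at eB
  rw [hDeq] at eD
  have sumU := measureReal_trichotomy μ U
  rw [hμ.goal] at sumU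
  have n₁ := measureReal_nonneg (μ := μ) (s := U ∩ SA)
  have n₂ := measureReal_nonneg (μ := μ) (s := U ∩ SB)
  have n₃ := measureReal_nonneg (μ := μ) (s := U ∩ SD)
  have n₄ := measureReal_nonneg (μ := μ) (s := V ∩ SA)
  have n₅ := measureReal_nonneg (μ := μ) (s := V ∩ SB)
  have n₆ := measureReal_nonneg (μ := μ) (s := V ∩ SD)
  have hi : ∀ {S : Set (ℝ × ℝ)} (r : ℝ), MeasurableSet S →
      Integrable (S.indicator fun _ => r) μ := fun r hS => (integrable_const r).indicator hS
  have hint : ∀ (W : Set (ℝ × ℝ)), MeasurableSet W → ∀ r s t : ℝ,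
      ∫ p, ((W ∩ SA).indicator (fun _ => r) p + (W ∩ SB).indicator (fun _ => s) p +
        (W ∩ SD).indicator (fun _ => t) p) ∂μ =
      μ.real (W ∩ SA) * r + μ.real (W ∩ SB) * s + μ.real (W ∩ SD) * t := fun W hW r s t => by
    rw [integral_add ((hi r (hW.inter mA)).fun_add (hi s (hW.inter mB))) (hi t (hW.inter mD)),
      integral_add (hi r (hW.inter mA)) (hi s (hW.inter mB)),
      integral_indicator_const _ (hW.inter mA), integral_indicator_const _ (hW.inter mB),
      integral_indicator_const _ (hW.inter mD)]
    simp only [smul_eq_mul]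
  have hI : Integrable (klotzLikelihood T) μ := hμ.integrable
  have mb : MeasurableSet {p : ℝ × ℝ | p.1 ≤ b} := measurableSet_fst_le b
  refine ⟨μ.real (U ∩ SA), μ.real (U ∩ SB), μ.real (U ∩ SD), ⟨n₁, by linarith, n₂, by linarith, n₃,
    by linarith, sumU, fun h0 => ?_⟩, ?_, ?_⟩
  -- For `ε = 0`, a point with `λ < x ≤ 0` would have negative `λ`.
  · rw [measureReal_eq_zero_iff]
    refine measure_mono_null (t := klotzRegionᶜ) (fun p hp hR => ?_) hμ.support
    obtain ⟨-, -, h3, -⟩ := mem_klotzRegion_iff.1 hR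
    have h1 : p.1 ≤ ε := hp.1
    have h2 : p.2 < p.1 := hp.2
    linarith
  -- The step function on the left is zero on the strip `ε < x ≤ b`, where `L ≥ 0` suffices.
  · rw [← hint U mU, ← integral_indicator mb]
    refine integral_mono_ae
      (((hi lA (mU.inter mA)).add (hi lB (mU.inter mB))).add (hi lD (mU.inter mD)))
      (hI.indicator mb) ?_
    filter_upwards [hμ.ae_mem] with p hp
    have hL := klotzLikelihood_nonneg T hp
    by_cases hpU : p.1 ≤ ε
    · have hpb : p.1 ≤ b := hpU.trans hεb.le
      rcases lt_trichotomy p.1 p.2 with h | h | h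
      · simpa [Set.indicator_apply, hU, hSA, hSB, hSD, hpU, hpb, h, h.not_gt, h.ne'] using
          hlA p ⟨hp, h⟩ hpU
      · simpa [Set.indicator_apply, hU, hSA, hSB, hSD, hpU, hpb, h.symm] using
          hlD p ⟨hp, h.symm⟩ hpU
      · simpa [Set.indicator_apply, hU, hSA, hSB, hSD, hpU, hpb, h, h.not_gt, h.ne] using
          hlB p ⟨hp, h⟩ hpU
    · simp only [Set.indicator_apply, hU, Set.mem_inter_iff, Set.mem_ofPred_eq, hpU, false_and,
        if_false, add_zero]
      split_ifs <;> simp [hL]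
  · have hsub : evidence T μ - ∫ p in {p | p.1 ≤ b}, klotzLikelihood T p ∂μ =
        ∫ p, V.indicator (klotzLikelihood T) p ∂μ := by
      have hc : {p : ℝ × ℝ | p.1 ≤ b}ᶜ = V := by ext p; simp [hV]
      rw [evidence, ← integral_add_compl mb hI, hc, integral_indicator mV]
      ring
    have hup : ∫ p, V.indicator (klotzLikelihood T) p ∂μ ≤
        μ.real (V ∩ SA) * hA + μ.real (V ∩ SB) * hB + μ.real (V ∩ SD) * hD := by
      rw [← hint V mV]
      refine integral_mono_ae (hI.indicator mV)
        (((hi hA (mV.inter mA)).add (hi hB (mV.inter mB))).add (hi hD (mV.inter mD))) ?_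
      filter_upwards [hμ.ae_mem] with p hp
      by_cases hpV : b < p.1
      · rcases lt_trichotomy p.1 p.2 with h | h | h
        · simpa [Set.indicator_apply, hV, hSA, hSB, hSD, hpV, h, h.not_gt, h.ne'] using
            hhA p ⟨hp, h⟩ hpV
        · have hhp := hhD p ⟨hp, h.symm⟩ hpV
          simpa [Set.indicator_apply, hV, hSA, hSB, hSD, hpV, h.symm] using hhp
        · simpa [Set.indicator_apply, hV, hSA, hSB, hSD, hpV, h, h.not_gt, h.ne] using
            hhB p ⟨hp, h⟩ hpV
      · simp [hV, hpV]
    rw [hsub]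
    refine hup.trans ?_
    -- The mass of the strip is credited to the high side; this only enlarges the bound, because
    -- `hA`, `hB` and `hD` are nonnegative.
    gcongr <;> linarith

end Bound

/-! ### Extremal locations of the likelihood. -/

section Locations

variable {n : ℕ} {T : Fin (n + 1) → Bool} {ε b φ₁ φ₂ θ a c d : ℝ}

lemma klotzRise_le_fst {p : ℝ × ℝ} (hp : p ∈ klotzRegion) (h : p.1 ≤ p.2) :
    klotzRise p.1 p.2 ≤ p.1 := by
  obtain ⟨h0, h1, h2, h3, h4⟩ := mem_klotzRegion_iff.1 hp
  exact div_le_of_le_mul₀ (by linarith) h0 (by nlinarith)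

lemma fst_le_klotzRise {p : ℝ × ℝ} (hp : p ∈ klotzRegion) (hx : p.1 < 1) (h : p.2 ≤ p.1) :
    p.1 ≤ klotzRise p.1 p.2 := by
  obtain ⟨h0, h1, h2, h3, h4⟩ := mem_klotzRegion_iff.1 hp
  rw [klotzRise, le_div_iff₀ (by linarith)]
  nlinarith

lemma klotzRise_diag {x : ℝ} (hx : x < 1) : klotzRise x x = x := by
  have : 1 - x ≠ 0 := by linarith
  rw [klotzRise]
  field_simp

lemma klotzLikelihood_diag_of_forall_false (hT : ∀ i, T i = false) {x : ℝ} (hx : x < 1) :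
    klotzLikelihood T (x, x) = (1 - x) ^ (transitions T false false + 1) := by
  rw [klotzLikelihood_of_forall_false hT, klotzRise_diag hx, pow_succ']

/-- Without failures the likelihood is at most its value at independence, below the diagonal. -/
lemma klotzLikelihood_le_of_snd_le (hT : ∀ i, T i = false) {p : ℝ × ℝ} (hp : p ∈ klotzRegion)
    (hb : b < 1) (hbp : b ≤ p.1) (h : p.2 ≤ p.1) :
    klotzLikelihood T p ≤ klotzLikelihood T (b, b) := by
  obtain ⟨h0, h1, h2, h3, h4⟩ := mem_klotzRegion_iff.1 hp
  obtain ⟨y0, y1⟩ := klotzRise_mem_Icc hp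
  rw [klotzLikelihood_diag_of_forall_false hT hb, klotzLikelihood_of_forall_false hT, pow_succ']
  rcases h1.lt_or_eq with hlt | heq
  · have := fst_le_klotzRise hp hlt h
    have h5 : 0 ≤ 1 - klotzRise p.1 p.2 := by linarith
    gcongr
    linarith
  -- At `x = 1` the comparison of `y` with `x` is not available, but the factor `1 - x` is zero.
  · rw [heq, sub_self, zero_mul]
    have : 0 ≤ 1 - b := by linarith
    positivity

lemma le_klotzLikelihood_of_le_snd (hT : ∀ i, T i = false) {p : ℝ × ℝ} (hp : p ∈ klotzRegion)
    (hε : ε < 1) (hpε : p.1 ≤ ε) (h : p.1 ≤ p.2) :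
    klotzLikelihood T (ε, ε) ≤ klotzLikelihood T p := by
  have := klotzRise_le_fst hp h
  rw [klotzLikelihood_diag_of_forall_false hT hε, klotzLikelihood_of_forall_false hT, pow_succ']
  have : 0 ≤ 1 - ε := by linarith
  gcongr <;> linarith

/-- Both `1 - x` and `1 - y` are smallest at `(ε, 0)`: `y` grows with `x` and decreases in `λ`. That
`ε < 1 / 2` keeps `y ≤ 1` there. -/
lemma le_klotzLikelihood_zero (hT : ∀ i, T i = false) {p : ℝ × ℝ} (hp : p ∈ klotzRegion)
    (hε : ε < 1 / 2) (hpε : p.1 ≤ ε) :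
    klotzLikelihood T (ε, 0) ≤ klotzLikelihood T p := by
  obtain ⟨h0, h1, h2, h3, h4⟩ := mem_klotzRegion_iff.1 hp
  have hrise : klotzRise p.1 p.2 ≤ klotzRise ε 0 := by
    unfold klotzRise
    rw [div_le_div_iff₀ (by linarith) (by linarith)]
    nlinarith [mul_nonneg h2 h0]
  have hε1 : klotzRise ε 0 ≤ 1 := by
    rw [klotzRise, div_le_one (by linarith)]
    linarith
  rw [klotzLikelihood_of_forall_false hT, klotzLikelihood_of_forall_false hT]
  have h5 : 0 ≤ 1 - klotzRise ε 0 := by linarith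
  have : 0 ≤ 1 - p.1 := by linarith
  simp only
  gcongr

/-- Without failures the likelihood is largest for complete positive dependence. -/
lemma klotzLikelihood_le_one_snd (hT : ∀ i, T i = false) {p : ℝ × ℝ} (hp : p ∈ klotzRegion)
    (hbp : b ≤ p.1) : klotzLikelihood T p ≤ klotzLikelihood T (b, 1) := by
  have := (klotzLikelihood_bounds T hp).2.1
  rw [if_neg (by simp [hT])] at this
  rw [klotzLikelihood_of_forall_false hT (b, 1)]
  simp only [klotzRise, sub_self, zero_mul, zero_div, sub_zero, one_pow, mul_one]
  linarith

/-- For `x ≤ 1 / 2` the lower bound `(2x - 1) / x` is not positive, so it adds nothing to `0 ≤ λ`.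
-/
lemma mem_klotzRegion_of_fst_le_half {x l : ℝ} (hx : 0 ≤ x) (hx' : x ≤ 1 / 2) (hl : 0 ≤ l)
    (hl' : l ≤ 1) : (x, l) ∈ klotzRegion := by
  rw [mem_klotzRegion_iff]
  have := mul_nonneg hl hx
  exact ⟨hx, by simp only; linarith, hl, hl', by simp only; linarith⟩

/-- The limit of a one-sided sequence of points `f t` with `t > 0`, `t → 0`. -/
lemma mem_closure_of_path {S : Set (ℝ × ℝ)} {p : ℝ × ℝ} (f : ℝ → ℝ × ℝ) (hf : Continuous f)
    (hp : f 0 = p) {r : ℝ} (hr : 0 < r) (hS : ∀ t, 0 < t → t < r → f t ∈ S) : p ∈ closure S := by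
  refine mem_closure_of_tendsto (f := f) (b := 𝓝[>] (0 : ℝ)) ?_ ?_
  · rw [← hp]
    exact hf.continuousWithinAt.tendsto
  · filter_upwards [Ioo_mem_nhdsGT hr] with t ht using hS t ht.1 ht.2

lemma diag_mem_closure_above (hε' : ε < 1 / 2) {x : ℝ} (hx : 0 ≤ x) (hxε : x ≤ ε) :
    (x, x) ∈ closure (regionAbove ∩ {q | q.1 ≤ ε}) := by
  refine mem_closure_of_path (fun t => (x, x + t)) (by fun_prop) (by simp)
    (r := 1 / 2) (by norm_num) fun t h0 h1 => ⟨⟨?_, ?_⟩, hxε⟩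
  · exact mem_klotzRegion_of_fst_le_half hx (by linarith) (by linarith) (by linarith)
  · exact lt_add_of_pos_right x h0

/-- The point `(b, l)` is approached from the right with slope `k`: horizontally off the diagonal
(`k = 0`), along the diagonal for `k = 1`. -/
lemma mem_closure_high {S : Set (ℝ × ℝ)} {l k : ℝ} (hb0 : 0 ≤ b) (hb : b < 1 / 2) (hl0 : 0 ≤ l)
    (hk0 : 0 ≤ k) (hlk : ∀ t, 0 < t → t < 1 / 2 - b → l + k * t ≤ 1)
    (hS : ∀ t, 0 < t → t < 1 / 2 - b → (b + t, l + k * t) ∈ klotzRegion →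
      (b + t, l + k * t) ∈ S) :
    (b, l) ∈ closure (S ∩ {q | b < q.1}) := by
  refine mem_closure_of_path (fun t => (b + t, l + k * t)) (by fun_prop) (by simp)
    (r := 1 / 2 - b) (by linarith) fun t h0 h1 => ⟨hS t h0 h1 ?_, lt_add_of_pos_right b h0⟩
  exact mem_klotzRegion_of_fst_le_half (by linarith) (by linarith)
    (by positivity) (hlk t h0 h1)

lemma snd_le_of_mem_closure_below {U : Set (ℝ × ℝ)} {p : ℝ × ℝ}
    (hp : p ∈ closure (regionBelow ∩ U)) : p.2 ≤ p.1 :=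
  closure_minimal (t := {q : ℝ × ℝ | q.2 ≤ q.1})
    (fun q h => le_of_lt (show q.2 < q.1 from h.1.2))
    (isClosed_le continuous_snd continuous_fst) hp

lemma le_snd_of_mem_closure_above {U : Set (ℝ × ℝ)} {p : ℝ × ℝ}
    (hp : p ∈ closure (regionAbove ∩ U)) : p.1 ≤ p.2 :=
  closure_minimal (t := {q : ℝ × ℝ | q.1 ≤ q.2})
    (fun q h => le_of_lt (show q.1 < q.2 from h.1.2))
    (isClosed_le continuous_fst continuous_snd) hp

lemma snd_eq_of_mem_closure_diag {U : Set (ℝ × ℝ)} {p : ℝ × ℝ}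
    (hp : p ∈ closure (regionDiag ∩ U)) : p.2 = p.1 :=
  closure_minimal (t := {q : ℝ × ℝ | q.2 = q.1})
    (fun _ h => h.1.2) (isClosed_eq continuous_snd continuous_fst) hp

lemma pos_of_below_nonempty (h : (regionBelow ∩ {q : ℝ × ℝ | q.1 ≤ ε}).Nonempty) : 0 < ε := by
  obtain ⟨r, ⟨hrR, hr⟩, hrε⟩ := h
  exact ((mem_klotzRegion_iff.1 hrR).2.2.1.trans_lt hr).trans_le hrε

lemma isPessimistic_noFailureDots (hT : ∀ i, T i = false) (hε : 0 ≤ ε) (hεb : ε < b)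
    (hb : b < 1 / 2) : (noFailureDots ε b).IsPessimistic T ε b where
  aboveLow _ := by
    refine ⟨diag_mem_closure_above (by linarith) hε le_rfl, fun p hp => ?_⟩
    exact le_klotzLikelihood_of_le_snd hT
      (closure_inter_subset_klotzRegion regionAbove_subset _ hp) (by linarith)
      (fst_le_of_mem_closure hp) (le_snd_of_mem_closure_above hp)
  belowLow := by
    intro hne
    have hε0 := pos_of_below_nonempty hne
    refine ⟨subset_closure ⟨⟨?_, hε0⟩, le_refl ε⟩, fun p hp => ?_⟩
    · exact mem_klotzRegion_of_fst_le_half hε (by linarith) le_rfl zero_le_one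
    · exact le_klotzLikelihood_zero hT (closure_inter_subset_klotzRegion regionBelow_subset _ hp)
        (by linarith) (fst_le_of_mem_closure hp)
  diagLow _ := by
    refine ⟨subset_closure ⟨⟨?_, rfl⟩, le_refl ε⟩, fun p hp => ?_⟩
    · exact mem_klotzRegion_of_fst_le_half hε (by linarith) hε (by linarith)
    · exact le_klotzLikelihood_of_le_snd hT
        (closure_inter_subset_klotzRegion regionDiag_subset _ hp) (by linarith)
        (fst_le_of_mem_closure hp) (snd_eq_of_mem_closure_diag hp).ge
  aboveHigh := by
    refine ⟨mem_closure_high (k := 0) (by linarith) hb zero_le_one le_rfl (fun t _ _ => by simp)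
      fun t h0 h1 hR => ⟨hR, ?_⟩, fun p hp => ?_⟩
    · simp only [zero_mul, add_zero]
      linarith
    · exact klotzLikelihood_le_one_snd hT
        (closure_inter_subset_klotzRegion regionAbove_subset _ hp) (le_fst_of_mem_closure hp)
  belowHigh := by
    refine ⟨mem_closure_high (k := 0) (by linarith) hb (by linarith) le_rfl
      (fun t _ _ => by linarith) fun t h0 h1 hR => ⟨hR, ?_⟩, fun p hp => ?_⟩
    · simp only [zero_mul, add_zero]
      linarith
    · exact klotzLikelihood_le_of_snd_le hT
        (closure_inter_subset_klotzRegion regionBelow_subset _ hp) (by linarith)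
        (le_fst_of_mem_closure hp) (snd_le_of_mem_closure_below hp)
  diagHigh := by
    refine ⟨mem_closure_high (k := 1) (by linarith) hb (by linarith) zero_le_one
      (fun t _ _ => by linarith) fun t h0 h1 hR => ⟨hR, ?_⟩, fun p hp => ?_⟩
    · simp only [one_mul]
    · exact klotzLikelihood_le_of_snd_le hT
        (closure_inter_subset_klotzRegion regionDiag_subset _ hp) (by linarith)
        (le_fst_of_mem_closure hp) (snd_eq_of_mem_closure_diag hp).le

lemma exists_isHighDot {S : Set (ℝ × ℝ)} (hS : S ⊆ klotzRegion)
    (hne : (S ∩ {q | b < q.1}).Nonempty) : ∃ p, IsHighDot T b S p := by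
  have hsub := closure_inter_subset_klotzRegion hS {q | b < q.1}
  exact (isCompact_klotzRegion.of_isClosed_subset isClosed_closure hsub).exists_isMaxOn
    hne.closure ((continuousOn_klotzLikelihood T).mono hsub)

lemma half_mem_above (hb : b < 1 / 2) :
    ((1 / 2, 3 / 4) : ℝ × ℝ) ∈ regionAbove ∩ {q | b < q.1} :=
  ⟨⟨mem_klotzRegion_of_fst_le_half (by norm_num) le_rfl (by norm_num) (by norm_num),
    by norm_num⟩, hb⟩

lemma half_mem_below (hb : b < 1 / 2) :
    ((1 / 2, 1 / 4) : ℝ × ℝ) ∈ regionBelow ∩ {q | b < q.1} :=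
  ⟨⟨mem_klotzRegion_of_fst_le_half (by norm_num) le_rfl (by norm_num) (by norm_num),
    by norm_num⟩, hb⟩

lemma half_mem_diag (hb : b < 1 / 2) :
    ((1 / 2, 1 / 2) : ℝ × ℝ) ∈ regionDiag ∩ {q | b < q.1} :=
  ⟨⟨mem_klotzRegion_of_fst_le_half (by norm_num) le_rfl (by norm_num) (by norm_num),
    by norm_num⟩, hb⟩

/-- The maximum is compared with an interior point at `x = 1 / 2`, where every factor of `L` is
positive. -/
lemma IsHighDot.pos {S : Set (ℝ × ℝ)} {p : ℝ × ℝ} (hp : IsHighDot T b S p) {l : ℝ} (hl0 : 0 < l)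
    (hl1 : l < 1) (hl : ((1 / 2, l) : ℝ × ℝ) ∈ S ∩ {q | b < q.1}) : 0 < klotzLikelihood T p := by
  refine lt_of_lt_of_le ?_ (hp.2 (subset_closure hl))
  refine klotzLikelihood_pos T ?_ ?_ hl0 hl1 ?_ <;> norm_num
  exact hl0

lemma isLowDot_of_eq_zero {S : Set (ℝ × ℝ)} (hS : S ⊆ klotzRegion) {p : ℝ × ℝ}
    (hp : (S ∩ {q | q.1 ≤ ε}).Nonempty → p ∈ closure (S ∩ {q | q.1 ≤ ε}))
    (h0 : klotzLikelihood T p = 0) : IsLowDot T ε S p := fun hne =>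
  ⟨hp hne, fun _ hq => h0.trans_le
    (klotzLikelihood_nonneg T (closure_inter_subset_klotzRegion hS _ hq))⟩

lemma zero_mem_closure_below (hε : 0 < ε) (hε' : ε < 1 / 2) :
    ((0, 0) : ℝ × ℝ) ∈ closure (regionBelow ∩ {q | q.1 ≤ ε}) :=
  mem_closure_of_path (fun t => (t, 0)) (by fun_prop) rfl hε fun _ h0 h1 =>
    ⟨⟨mem_klotzRegion_of_fst_le_half h0.le (by linarith) le_rfl zero_le_one, h0⟩, h1.le⟩

/-- High points exist by compactness. For the low ones it suffices that `L` vanishes: at `x = 0`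
because of the failure, and at `(ε, 0)` through `λ ^ γ` if `γ > 0`. -/
lemma exists_isPessimistic (hT : ∃ i, T i = true) (hε : 0 ≤ ε) (hεb : ε < b) (hb : b < 1 / 2) :
    ∃ q : Dots, q.IsPessimistic T ε b ∧ q.aboveLow = (0, 0) ∧ q.diagLow = (0, 0) ∧
      (0 < transitions T true true → q.belowLow = (ε, 0)) ∧
      (transitions T true true = 0 → q.belowLow = (0, 0)) := by
  obtain ⟨p₄, h₄⟩ := exists_isHighDot (T := T) regionAbove_subset ⟨_, half_mem_above hb⟩
  obtain ⟨p₅, h₅⟩ := exists_isHighDot (T := T) regionBelow_subset ⟨_, half_mem_below hb⟩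
  obtain ⟨p₆, h₆⟩ := exists_isHighDot (T := T) regionDiag_subset ⟨_, half_mem_diag hb⟩
  have hz := klotzLikelihood_zero_of_failure hT 0
  have h₁ : IsLowDot T ε regionAbove (0, 0) := isLowDot_of_eq_zero regionAbove_subset
    (fun _ => diag_mem_closure_above (by linarith) le_rfl hε) hz
  have h₃ : IsLowDot T ε regionDiag (0, 0) := isLowDot_of_eq_zero regionDiag_subset
    (fun _ => subset_closure ⟨⟨mem_klotzRegion_of_fst_le_half le_rfl (by norm_num) le_rfl
      zero_le_one, rfl⟩, hε⟩) hz
  rcases Nat.eq_zero_or_pos (transitions T true true) with h0 | hγ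
  · refine ⟨⟨(0, 0), (0, 0), (0, 0), p₄, p₅, p₆⟩, ⟨h₁, ?_, h₃, h₄, h₅, h₆⟩, rfl, rfl,
      fun h => absurd h0 h.ne', fun _ => rfl⟩
    exact isLowDot_of_eq_zero regionBelow_subset
      (fun hne => zero_mem_closure_below (pos_of_below_nonempty hne) (by linarith)) hz
  · refine ⟨⟨(0, 0), (ε, 0), (0, 0), p₄, p₅, p₆⟩, ⟨h₁, ?_, h₃, h₄, h₅, h₆⟩, rfl, rfl,
      fun _ => rfl, fun h => absurd h hγ.ne'⟩
    refine isLowDot_of_eq_zero regionBelow_subset (fun hne => subset_closure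
      ⟨⟨mem_klotzRegion_of_fst_le_half hε (by linarith) le_rfl zero_le_one,
        pos_of_below_nonempty hne⟩, le_refl ε⟩) ?_
    simp [klotzLikelihood, hγ.ne']

end Locations

/-! ### Optimal splits, with and without failures. -/

section Solution

variable {n : ℕ} {T : Fin (n + 1) → Bool} {ε b φ₁ φ₂ θ a c d : ℝ}

lemma low_above_nonempty (hε : 0 ≤ ε) : (regionAbove ∩ {q : ℝ × ℝ | q.1 ≤ ε}).Nonempty :=
  ⟨(0, 1), ⟨mem_klotzRegion_of_fst_le_half le_rfl (by norm_num) zero_le_one le_rfl,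
    by simp⟩, hε⟩

lemma low_diag_nonempty (hε : 0 ≤ ε) : (regionDiag ∩ {q : ℝ × ℝ | q.1 ≤ ε}).Nonempty :=
  ⟨(0, 0), ⟨mem_klotzRegion_of_fst_le_half le_rfl (by norm_num) le_rfl zero_le_one, rfl⟩, hε⟩

lemma low_below_nonempty (hε : 0 < ε) (hε' : ε < 1 / 2) :
    (regionBelow ∩ {q : ℝ × ℝ | q.1 ≤ ε}).Nonempty :=
  ⟨(ε, 0), ⟨mem_klotzRegion_of_fst_le_half hε.le hε'.le le_rfl zero_le_one, hε⟩, le_refl ε⟩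

/-- Makes the choice among several minimisers immaterial: values may be computed at explicit
locations. -/
lemma IsLowDot.likelihood_eq {S : Set (ℝ × ℝ)} {p p' : ℝ × ℝ} (h : IsLowDot T ε S p)
    (h' : IsLowDot T ε S p') (hne : (S ∩ {q | q.1 ≤ ε}).Nonempty) :
    klotzLikelihood T p = klotzLikelihood T p' :=
  le_antisymm ((h hne).2 (h' hne).1) ((h' hne).2 (h hne).1)

lemma IsHighDot.likelihood_eq {S : Set (ℝ × ℝ)} {p p' : ℝ × ℝ} (h : IsHighDot T b S p)
    (h' : IsHighDot T b S p') : klotzLikelihood T p = klotzLikelihood T p' :=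
  le_antisymm (h'.2 h.1) (h.2 h'.1)

/-- Posterior under a prior on limit points: only the low locations count. -/
lemma Dots.IsPessimistic.posterior_eq {q : Dots} (hq : q.IsPessimistic T ε b) (hε : 0 ≤ ε)
    (hεb : ε < b) (hb : b < 1 / 2) (h : IsSplit ε φ₁ φ₂ θ a c d) :
    posterior T (q.prior φ₁ φ₂ a c d) {p | p.1 < b} =
      (a * klotzLikelihood T q.aboveLow + c * klotzLikelihood T q.belowLow +
        d * klotzLikelihood T q.diagLow) / evidence T (q.prior φ₁ φ₂ a c d) := by
  refine posterior_prior T q h (measurableSet_fst_lt b)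
    ((fst_le_of_mem_closure (hq.aboveLow (low_above_nonempty hε)).1).trans_lt hεb)
    (fun hc => ?_)
    ((fst_le_of_mem_closure (hq.diagLow (low_diag_nonempty hε)).1).trans_lt hεb)
    (not_lt.2 (le_fst_of_mem_closure hq.aboveHigh.1))
    (not_lt.2 (le_fst_of_mem_closure hq.belowHigh.1))
    (not_lt.2 (le_fst_of_mem_closure hq.diagHigh.1))
  have hε' : 0 < ε := hε.lt_of_ne fun h' => hc (h.below_eq_zero h'.symm)
  exact (fst_le_of_mem_closure
    (hq.belowLow (low_below_nonempty hε' (by linarith))).1).trans_lt hεb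

/-- With failures every admissible split solves the problem, with posterior probability zero. -/
lemma Dots.IsPessimistic.solvesProblem_of_failure {q : Dots} (hq : q.IsPessimistic T ε b)
    (hT : ∃ i, T i = true) (hε : 0 ≤ ε) (hεb : ε < b) (hb : b < 1 / 2) (hθ : θ < 1)
    (h : IsSplit ε φ₁ φ₂ θ a c d) :
    SolvesProblem T ε b φ₁ φ₂ θ (q.prior φ₁ φ₂ a c d) ∧
      posterior T (q.prior φ₁ φ₂ a c d) {p | p.1 < b} = 0 := by
  obtain ⟨q', hq', hA', hD', -⟩ := exists_isPessimistic hT hε hεb hb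
  have hz := klotzLikelihood_zero_of_failure hT 0
  have hA : klotzLikelihood T q.aboveLow = 0 := by
    rw [hq.aboveLow.likelihood_eq hq'.aboveLow (low_above_nonempty hε), hA', hz]
  have hD : klotzLikelihood T q.diagLow = 0 := by
    rw [hq.diagLow.likelihood_eq hq'.diagLow (low_diag_nonempty hε), hD', hz]
  have hB : c * klotzLikelihood T q.belowLow = 0 := by
    rcases hε.eq_or_lt with h0 | h0
    · rw [h.below_eq_zero h0.symm, zero_mul]
    · have hz' : IsLowDot T ε regionBelow (0, 0) := isLowDot_of_eq_zero regionBelow_subset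
        (fun _ => zero_mem_closure_below h0 (by linarith)) hz
      rw [hq.belowLow.likelihood_eq hz' (low_below_nonempty h0 (by linarith)), hz, mul_zero]
  have hpost : posterior T (q.prior φ₁ φ₂ a c d) {p | p.1 < b} = 0 := by
    rw [hq.posterior_eq hε hεb hb h, hA, hB, hD]
    simp
  have pA := hq.aboveHigh.pos (by norm_num) (by norm_num) (half_mem_above hb)
  have pB := hq.belowHigh.pos (by norm_num) (by norm_num) (half_mem_below hb)
  have pD := hq.diagHigh.pos (by norm_num) (by norm_num) (half_mem_diag hb)
  refine ⟨hq.solvesProblem T hε hεb hb h ?_ ?_, hpost⟩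
  · rw [evidence, integral_prior q h, hA, hB, hD]
    have w₁ := sub_nonneg.2 h.above_le
    have w₂ := sub_nonneg.2 h.below_le
    have w₃ := sub_nonneg.2 h.diag_le
    have hs := h.sum_eq
    have t₁ := mul_nonneg w₁ pA.le
    have t₂ := mul_nonneg w₂ pB.le
    have t₃ := mul_nonneg w₃ pD.le
    simp only [mul_zero, add_zero, zero_add]
    -- The three high weights add up to `1 - θ > 0`, so at least one is positive.
    rcases w₁.eq_or_lt with e₁ | e₁
    · rcases w₂.eq_or_lt with e₂ | e₂
      · have e₃ : 0 < 1 - φ₁ - φ₂ - d := by linarith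
        linarith [mul_pos e₃ pD]
      · linarith [mul_pos e₂ pB]
    · linarith [mul_pos e₁ pA]
  · rw [hpost]
    rintro _ ⟨μ, hμ, -, rfl⟩
    exact posterior_nonneg hμ _

/-- Monotonicity of `u / (u + v)` in both variables: `u * e ≤ u * u' + u * v ≤ u' * (u + v)`. -/
lemma div_add_le_div_of_le {u v u' e : ℝ} (hu : 0 ≤ u) (hv : 0 ≤ v) (huu : u ≤ u')
    (hve : e - u' ≤ v) (huv : 0 < u + v) (he : 0 < e) : u / (u + v) ≤ u' / e := by
  rw [div_le_div_iff₀ huv he]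
  linarith [mul_le_mul_of_nonneg_left hve hu, mul_le_mul_of_nonneg_right huu hv]

/-- Without failures a split solves the problem if it puts as little low probability as possible
above the diagonal and as much as possible below. -/
lemma Dots.IsPessimistic.solvesProblem_of_no_failure {q : Dots} (hq : q.IsPessimistic T ε b)
    (hT : ∀ i, T i = false) (hε : 0 ≤ ε) (hεb : ε < b) (hb : b < 1 / 2)
    (h : IsSplit ε φ₁ φ₂ θ a c d)
    (hopt : ∀ a' c' d', IsSplit ε φ₁ φ₂ θ a' c' d' → a ≤ a' ∧ c' ≤ c) :
    SolvesProblem T ε b φ₁ φ₂ θ (q.prior φ₁ φ₂ a c d) := by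
  have hn := isPessimistic_noFailureDots hT hε hεb hb
  have hRε : (ε, (0 : ℝ)) ∈ klotzRegion :=
    mem_klotzRegion_of_fst_le_half hε (by linarith) le_rfl zero_le_one
  have hRb : (b, (1 : ℝ)) ∈ klotzRegion :=
    mem_klotzRegion_of_fst_le_half (by linarith) hb.le zero_le_one le_rfl
  have hRε' : (ε, ε) ∈ klotzRegion :=
    mem_klotzRegion_of_fst_le_half hε (by linarith) hε (by linarith)
  have hRb' : (b, b) ∈ klotzRegion :=
    mem_klotzRegion_of_fst_le_half (by linarith) hb.le (by linarith) (by linarith)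
  set lA := klotzLikelihood T (ε, ε) with hlA
  set lB := klotzLikelihood T (ε, 0) with hlB
  set hA := klotzLikelihood T (b, 1) with hhA
  set hB := klotzLikelihood T (b, b) with hhB
  have hlBA : lB ≤ lA := le_klotzLikelihood_zero hT hRε' (by linarith) le_rfl
  have hBA : hB ≤ hA := klotzLikelihood_le_one_snd hT hRb' le_rfl
  have hlB0 : 0 < lB := by
    rw [hlB, klotzLikelihood_of_forall_false hT]
    have h1 : 0 < 1 - klotzRise ε 0 := by
      rw [sub_pos, klotzRise, div_lt_one (by linarith)]
      linarith
    have h2 : 0 < 1 - ε := by linarith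
    positivity
  have hB0 : 0 < hB := by
    rw [hhB, klotzLikelihood_diag_of_forall_false hT (by linarith)]
    exact pow_pos (by linarith) _
  have e₁ : klotzLikelihood T q.aboveLow = lA :=
    hq.aboveLow.likelihood_eq hn.aboveLow (low_above_nonempty hε)
  have e₃ : klotzLikelihood T q.diagLow = lA :=
    hq.diagLow.likelihood_eq hn.diagLow (low_diag_nonempty hε)
  have e₂ : c * klotzLikelihood T q.belowLow = c * lB := by
    rcases hε.eq_or_lt with h0 | h0
    · rw [h.below_eq_zero h0.symm, zero_mul, zero_mul]
    · exact congrArg (c * ·)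
        (hq.belowLow.likelihood_eq hn.belowLow (low_below_nonempty h0 (by linarith)))
  have e₄ : klotzLikelihood T q.aboveHigh = hA := hq.aboveHigh.likelihood_eq hn.aboveHigh
  have e₅ : klotzLikelihood T q.belowHigh = hB := hq.belowHigh.likelihood_eq hn.belowHigh
  have e₆ : klotzLikelihood T q.diagHigh = hB := hq.diagHigh.likelihood_eq hn.diagHigh
  have hev : evidence T (q.prior φ₁ φ₂ a c d) = (a * lA + c * lB + d * lA) +
      ((φ₂ - a) * hA + (φ₁ - c) * hB + (1 - φ₁ - φ₂ - d) * hB) := by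
    rw [evidence, integral_prior q h, e₁, e₂, e₃, e₄, e₅, e₆]
  obtain ⟨ha, ha', hc, hc', hd, hd', hs, -⟩ := id h
  -- These crude bounds on `u` and `v` yield their nonnegativity, and positive evidence, since `θ`
  -- and `1 - θ` are not both zero.
  have hu : θ * lB ≤ a * lA + c * lB + d * lA := by
    rw [← hs]
    linarith [mul_nonneg (add_nonneg ha hd) (sub_nonneg.2 hlBA)]
  have hv : (1 - θ) * hB ≤ (φ₂ - a) * hA + (φ₁ - c) * hB + (1 - φ₁ - φ₂ - d) * hB := by
    rw [← hs]
    linarith [mul_nonneg (sub_nonneg.2 ha') (sub_nonneg.2 hBA)]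
  have hθ0 : 0 ≤ θ := by linarith
  have hθ1 : 0 ≤ 1 - θ := by linarith
  have hpos : 0 < evidence T (q.prior φ₁ φ₂ a c d) := by
    rw [hev]
    rcases hθ0.eq_or_lt with h0 | h0
    · have := mul_pos (show 0 < 1 - θ by linarith) hB0
      have := mul_nonneg hθ0 hlB0.le
      linarith
    · have := mul_pos h0 hlB0
      have := mul_nonneg hθ1 hB0.le
      linarith
  refine hq.solvesProblem T hε hεb hb h hpos ?_
  rw [hq.posterior_eq hε hεb hb h, e₁, e₂, e₃]
  rintro _ ⟨μ, hμ, hμpos, rfl⟩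
  obtain ⟨a', c', d', hsp, hU, hV⟩ := hμ.exists_split (T := T) hεb
    (lA := lA) (lB := lB) (lD := lA) (hA := hA) (hB := hB) (hD := hB)
    (fun p hp hpε => le_klotzLikelihood_of_le_snd hT hp.1 (by linarith) hpε (le_of_lt hp.2))
    (fun p hp hpε => le_klotzLikelihood_zero hT hp.1 (by linarith) hpε)
    (fun p hp hpε => le_klotzLikelihood_of_le_snd hT hp.1 (by linarith) hpε (ge_of_eq hp.2))
    (fun p hp hpb => klotzLikelihood_le_one_snd hT hp.1 hpb.le)
    (fun p hp hpb => klotzLikelihood_le_of_snd_le hT hp.1 (by linarith) hpb.le (le_of_lt hp.2))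
    (fun p hp hpb => klotzLikelihood_le_of_snd_le hT hp.1 (by linarith) hpb.le (le_of_eq hp.2))
    (hB0.le.trans hBA) hB0.le hB0.le
  obtain ⟨hoa, hoc⟩ := hopt a' c' d' hsp
  have hs' := hsp.sum_eq
  -- Eliminating `d` gives `u = θ * lA - c * (lA - lB)` and, for the high part, `v = (1 - θ) * hB +
  -- (φ₂ - a) * (hA - hB)`.
  have hu' : a * lA + c * lB + d * lA ≤ a' * lA + c' * lB + d' * lA := by
    obtain rfl : d = θ - a - c := by linarith
    obtain rfl : d' = θ - a' - c' := by linarith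
    linarith [mul_nonneg (sub_nonneg.2 hoc) (sub_nonneg.2 hlBA)]
  have hv' : (φ₂ - a') * hA + (φ₁ - c') * hB + (1 - φ₁ - φ₂ - d') * hB ≤
      (φ₂ - a) * hA + (φ₁ - c) * hB + (1 - φ₁ - φ₂ - d) * hB := by
    obtain rfl : d = θ - a - c := by linarith
    obtain rfl : d' = θ - a' - c' := by linarith
    linarith [mul_nonneg (sub_nonneg.2 hoa) (sub_nonneg.2 hBA)]
  rw [hev] at hpos ⊢
  exact div_add_le_div_of_le ((mul_nonneg hθ0 hlB0.le).trans hu)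
    ((mul_nonneg hθ1 hB0.le).trans hv) (hu'.trans hU) (hV.trans hv') hpos hμpos

/-- The mass `θ` fills the part above first, then the diagonal, and goes below only if forced; for
`ε = 0` the compatibility condition makes that last amount zero. -/
lemma exists_isSplit (hφ₁ : 0 ≤ φ₁) (hφ₂ : 0 ≤ φ₂) (hφ : φ₁ + φ₂ ≤ 1) (hθ₀ : 0 ≤ θ) (hθ₁ : θ ≤ 1)
    (hcompat : ε = 0 → φ₁ + θ ≤ 1) : ∃ a c d, IsSplit ε φ₁ φ₂ θ a c d := by
  rcases le_total θ φ₂ with h | h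
  · exact ⟨θ, 0, 0, by constructor <;> first | exact fun _ => rfl | linarith⟩
  · rcases le_total φ₁ (1 - θ) with h' | h'
    · exact ⟨φ₂, 0, θ - φ₂, by constructor <;> first | exact fun _ => rfl | linarith⟩
    · refine ⟨φ₂, φ₁ - (1 - θ), 1 - φ₁ - φ₂, ?_⟩
      constructor <;> first | (intro h0; linarith [hcompat h0]) | linarith

end Solution

/-! ### Verification of the cases. -/

theorem theorem6 {n : ℕ} (T : Fin (n + 1) → Bool) (ε b φ₁ φ₂ θ : ℝ)
    (hε : 0 ≤ ε) (hεb : ε < b) (hb : b < 1 / 2)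
    (hφ₁ : 0 ≤ φ₁) (hφ₂ : 0 ≤ φ₂) (hφ : φ₁ + φ₂ ≤ 1) (hθ₀ : 0 ≤ θ) (hθ₁ : θ ≤ 1)
    (hcompat : ε = 0 → φ₁ + θ ≤ 1)
    (hfail : (∃ i, T i = true) → θ < 1) :
    -- the pessimistic locations without failures
    ((∀ i, T i = false) → (noFailureDots ε b).IsPessimistic T ε b) ∧
    -- the pessimistic locations with failures
    ((∃ i, T i = true) → ∃ q : Dots, q.IsPessimistic T ε b ∧
      q.aboveLow = (0, 0) ∧ q.diagLow = (0, 0) ∧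
      (0 < transitions T true true → q.belowLow = (ε, 0)) ∧
      (transitions T true true = 0 → q.belowLow = (0, 0))) ∧
    -- worst-case priors when there are no failures, or some consecutive failures
    (∀ q : Dots, q.IsPessimistic T ε b →
      ((∀ i, T i = false) ∨ 0 < transitions T true true) → 0 < ε →
        (θ ≤ φ₁ → SolvesProblem T ε b φ₁ φ₂ θ (q.prior φ₁ φ₂ 0 θ 0)) ∧
        (φ₁ ≤ θ → φ₂ ≤ 1 - θ →
          SolvesProblem T ε b φ₁ φ₂ θ (q.prior φ₁ φ₂ 0 φ₁ (θ - φ₁))) ∧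
        (1 - θ ≤ φ₂ →
          SolvesProblem T ε b φ₁ φ₂ θ
            (q.prior φ₁ φ₂ (φ₂ - (1 - θ)) φ₁ (1 - φ₁ - φ₂)))) ∧
    -- worst-case priors when there are failures, but no consecutive failures
    (∀ q : Dots, q.IsPessimistic T ε b →
      (∃ i, T i = true) → transitions T true true = 0 →
        (θ ≤ φ₂ → SolvesProblem T ε b φ₁ φ₂ θ (q.prior φ₁ φ₂ θ 0 0)) ∧
        (φ₁ ≤ 1 - θ → φ₂ ≤ θ →
          SolvesProblem T ε b φ₁ φ₂ θ (q.prior φ₁ φ₂ φ₂ 0 (θ - φ₂))) ∧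
        (1 - θ ≤ φ₁ →
          SolvesProblem T ε b φ₁ φ₂ θ
            (q.prior φ₁ φ₂ φ₂ (φ₁ - (1 - θ)) (1 - φ₁ - φ₂)))) ∧
    -- worst-case priors when `ε = 0` (then no probability below the diagonal has `x ≤ ε`)
    (∀ q : Dots, q.IsPessimistic T ε b → ε = 0 →
        (θ ≤ 1 - φ₁ - φ₂ → SolvesProblem T ε b φ₁ φ₂ θ (q.prior φ₁ φ₂ 0 0 θ)) ∧
        (1 - φ₁ - φ₂ ≤ θ →
          SolvesProblem T ε b φ₁ φ₂ θ
            (q.prior φ₁ φ₂ (θ - (1 - φ₁ - φ₂)) 0 (1 - φ₁ - φ₂)))) ∧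
    -- with failures the infimum is zero
    ((∃ i, T i = true) → IsGLB (posteriorValues T ε b φ₁ φ₂ θ) 0) := by
  refine ⟨fun hT => isPessimistic_noFailureDots hT hε hεb hb,
    fun hT => exists_isPessimistic hT hε hεb hb, fun q hq hcase hε0 => ?_,
    fun q hq hT hγ => ?_, fun q hq h0 => ?_, fun hT => ?_⟩
  -- Optimality of the split matters only without failures; otherwise any split works.
  · have key : ∀ {a c d : ℝ}, IsSplit ε φ₁ φ₂ θ a c d →
        (∀ a' c' d', IsSplit ε φ₁ φ₂ θ a' c' d' → a ≤ a' ∧ c' ≤ c) →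
        SolvesProblem T ε b φ₁ φ₂ θ (q.prior φ₁ φ₂ a c d) := fun h hopt => by
      by_cases hT : ∃ i, T i = true
      · exact (hq.solvesProblem_of_failure hT hε hεb hb (hfail hT) h).1
      · exact hq.solvesProblem_of_no_failure (by simpa using hT) hε hεb hb h hopt
    have hne : ε ≠ 0 := hε0.ne'
    refine ⟨fun h => key ?_ ?_, fun h h' => key ?_ ?_, fun h => key ?_ ?_⟩
    · constructor <;> first | exact fun h0 => absurd h0 hne | linarith
    · rintro a c d ⟨h1, h2, h3, h4, h5, h6, h7, -⟩
      constructor <;> linarith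
    · constructor <;> first | exact fun h0 => absurd h0 hne | linarith
    · rintro a c d ⟨h1, h2, h3, h4, h5, h6, h7, -⟩
      constructor <;> linarith
    · constructor <;> first | exact fun h0 => absurd h0 hne | linarith
    -- Full mass below and on the diagonal leaves the least possible above: `a = θ - c - d ≥ θ - φ₁
    -- - (1 - φ₁ - φ₂)`.
    · rintro a c d ⟨h1, h2, h3, h4, h5, h6, h7, -⟩
      constructor <;> linarith
  · have key : ∀ {a c d : ℝ}, IsSplit ε φ₁ φ₂ θ a c d →
        SolvesProblem T ε b φ₁ φ₂ θ (q.prior φ₁ φ₂ a c d) := fun h =>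
      (hq.solvesProblem_of_failure hT hε hεb hb (hfail hT) h).1
    refine ⟨fun h => key ?_, fun h h' => key ?_, fun h => key ?_⟩
    · constructor <;> first | exact fun _ => rfl | linarith
    · constructor <;> first | exact fun _ => rfl | linarith
    · constructor <;> first | (intro h0; linarith [hcompat h0]) | linarith
  · have key : ∀ {a c d : ℝ}, IsSplit ε φ₁ φ₂ θ a c d →
        (∀ a' c' d', IsSplit ε φ₁ φ₂ θ a' c' d' → a ≤ a' ∧ c' ≤ c) →
        SolvesProblem T ε b φ₁ φ₂ θ (q.prior φ₁ φ₂ a c d) := fun h hopt => by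
      by_cases hT : ∃ i, T i = true
      · exact (hq.solvesProblem_of_failure hT hε hεb hb (hfail hT) h).1
      · exact hq.solvesProblem_of_no_failure (by simpa using hT) hε hεb hb h hopt
    have hc := hcompat h0
    refine ⟨fun h => key ?_ ?_, fun h => key ?_ ?_⟩
    · constructor <;> first | exact fun _ => rfl | linarith
    · rintro a c d ⟨h1, h2, h3, h4, h5, h6, h7, h8⟩
      -- With `ε = 0` every split has `c = 0`, so only the minimality of the mass above is at stake.
      have := h8 h0
      constructor <;> linarith
    · constructor <;> first | exact fun _ => rfl | linarith
    · rintro a c d ⟨h1, h2, h3, h4, h5, h6, h7, h8⟩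
      have := h8 h0
      constructor <;> linarith
  · obtain ⟨q, hq, -⟩ := exists_isPessimistic hT hε hεb hb
    obtain ⟨a, c, d, h⟩ := exists_isSplit hφ₁ hφ₂ hφ hθ₀ hθ₁ hcompat
    obtain ⟨hsol, h0⟩ := hq.solvesProblem_of_failure hT hε hεb hb (hfail hT) h
    exact h0 ▸ hsol.isGLB
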